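/- Let $m\ge 2$. For $r>0$ let $B_r$ be the open ball of radius $r$ around $0$ in $\mathbb R^m$ and let the sphere $\partial B_r$ carry its natural surface measure. For $0<r<\eta$ let $$C(\partial B_r,B_\eta):=\sup_{0\ne u\in H^1(B_\eta)}\frac{\|u|_{\partial B_r}\|_{L^2(\partial B_r)}}{\|u\|_{H^1(B_\eta)}},\qquad \|u\|_{H^1(B_\eta)}^2=\int_{B_\eta}\bigl(|u|^2+|\nabla u|^2\bigr)\,dx,$$ be the optimal Sobolev trace constant, where $u|_{\partial B_r}$ is the trace of the complex-valued function $u$ on $\partial B_r$. Let $\gamma$ be Euler's constant, and put $$h_2(r):=(\log 2-\gamma-\log r)\,r,\qquad h_m(r):=\frac r{m-2}\quad(m\ge 3).$$ Then $0.115<\log 2-\gamma<0.116$, the constant $C(\partial B_r,B_\eta)$ is finite for all $0<r<\eta$, and if the remainder $R'_m(r,\eta)$ is defined by $$C(\partial B_r,B_\eta)^2=\frac{m r^{m-1}}{\eta^m}+h_m(r)+R'_m(r,\eta),$$ then there are constants $c'_m>0$ and $\eta_m\in(0,1]$, depending only on $m$, such that $$|R'_m(r,\eta)|\le c'_m\Bigl(\frac{r^{m-1}}{\eta^m}\cdot[-\log\eta]_2\,\eta^2+r^2\Bigr)\qquad\text{for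 all }0<r<\eta<\eta_m,$$ where $[-\log\eta]_2:=-\log\eta$ if $m=2$ and $[-\log\eta]_2:=1$ if $m\ge 3$. Moreover, for every $0<\eta<\eta_m$ the function $r\mapsto C(\partial B_r,B_\eta)$ is monotonically increasing on $(0,\eta)$. -/

import Mathlib

open MeasureTheory Set Filter Topology
open scoped ENNReal ContDiff

namespace SobolevTrace

noncomputable section

/-- Euclidean space `ℝ^m`. -/
abbrev E (m : ℕ) : Type := EuclideanSpace ℝ (Fin m)

/-- The open ball `B_r` of radius `r` around `0` in `ℝ^m`. -/
abbrev B (m : ℕ) (r : ℝ) : Set (E m) := Metric.ball 0 r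

/-- The natural surface measure of the sphere `∂B_r` (for `r > 0`), as a measure on `ℝ^m`:
the image of the surface measure of the unit sphere under `θ ↦ r θ`, multiplied by `r^(m-1)`. -/
def surfaceMeasure (m : ℕ) (r : ℝ) : Measure (E m) :=
  ENNReal.ofReal (r ^ (m - 1)) •
    ((volume : Measure (E m)).toSphere.map fun θ : Metric.sphere (0 : E m) 1 => r • (θ : E m))

/-- The partial derivatives `(∂_1 φ, …, ∂_m φ)` of a complex-valued function on `ℝ^m`. -/
def grad {m : ℕ} (φ : E m → ℂ) (x : E m) : EuclideanSpace ℂ (Fin m) :=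
  WithLp.toLp 2 fun i => fderiv ℝ φ x (EuclideanSpace.single i 1)

/-- `G` is the gradient of `u` on the open set `U` in the weak (distributional) sense. -/
def IsWeakGradient {m : ℕ} (U : Set (E m)) (u : E m → ℂ)
    (G : E m → EuclideanSpace ℂ (Fin m)) : Prop :=
  ∀ φ : E m → ℝ, ContDiff ℝ ∞ φ → HasCompactSupport φ → tsupport φ ⊆ U →
    ∀ i : Fin m,
      ∫ x in U, u x * ((fderiv ℝ φ x (EuclideanSpace.single i 1) : ℝ) : ℂ)
        = - ∫ x in U, G x i * ((φ x : ℝ) : ℂ)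

/-- `u` belongs to the Sobolev space `H^1(U)` and has the weak gradient `G`. -/
structure IsH1 {m : ℕ} (U : Set (E m)) (u : E m → ℂ)
    (G : E m → EuclideanSpace ℂ (Fin m)) : Prop where
  memLp : MemLp u 2 (volume.restrict U)
  memLp_grad : MemLp G 2 (volume.restrict U)
  weakGradient : IsWeakGradient U u G

/-- The norm `(∫_U (|u|² + |G|²))^{1/2}`; this is the norm of `H^1(U)` if `G` is the weak gradient
of `u`. -/
def h1Norm {m : ℕ} (U : Set (E m)) (u : E m → ℂ)
    (G : E m → EuclideanSpace ℂ (Fin m)) : ℝ≥0∞ :=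
  (∫⁻ x in U, (‖u x‖ₑ ^ 2 + ‖G x‖ₑ ^ 2)) ^ (1 / 2 : ℝ)

/-- The norm `‖g‖` of `L²(∂B_r)`. -/
def sphereNorm {m : ℕ} (r : ℝ) (g : E m → ℂ) : ℝ≥0∞ :=
  (∫⁻ x, ‖g x‖ₑ ^ 2 ∂(surfaceMeasure m r)) ^ (1 / 2 : ℝ)

/-- `g ∈ L²(∂B_r)` is the trace on `∂B_r` of the function `u ∈ H^1(B_η)` with weak gradient `G`:
there are smooth functions `φ_n` on `ℝ^m` that converge to `u` in `H^1(B_η)` and whose restrictions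
to `∂B_r` converge to `g` in `L²(∂B_r)`. In other words, the trace is the continuous extension of
the restriction map `φ ↦ φ|_{∂B_r}` from the dense subspace of smooth functions. -/
def IsTrace {m : ℕ} (r η : ℝ) (u : E m → ℂ) (G : E m → EuclideanSpace ℂ (Fin m))
    (g : E m → ℂ) : Prop :=
  MemLp g 2 (surfaceMeasure m r) ∧
    ∃ φ : ℕ → E m → ℂ, (∀ n, ContDiff ℝ ∞ (φ n)) ∧
      Tendsto (fun n => h1Norm (B m η) (fun x => φ n x - u x) (fun x => grad (φ n) x - G x))
        atTop (𝓝 0) ∧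
      Tendsto (fun n => sphereNorm r (fun x => φ n x - g x)) atTop (𝓝 0)

/-- The optimal Sobolev trace constant `C(∂B_r, B_η)`, as an extended nonnegative real: the supremum
of `‖u|_{∂B_r}‖_{L²(∂B_r)} / ‖u‖_{H^1(B_η)}` over all nonzero `u ∈ H^1(B_η)`. -/
def optTraceConst (m : ℕ) (r η : ℝ) : ℝ≥0∞ :=
  sSup {q : ℝ≥0∞ | ∃ (u : E m → ℂ) (G : E m → EuclideanSpace ℂ (Fin m)) (g : E m → ℂ),
    IsH1 (B m η) u G ∧ h1Norm (B m η) u G ≠ 0 ∧ IsTrace r η u G g ∧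
      q = sphereNorm r g / h1Norm (B m η) u G}

/-- `h_2(r) = (log 2 - γ - log r) r`, and `h_m(r) = r / (m - 2)` for `m ≥ 3`, where `γ` is Euler's
constant. -/
def hTerm (m : ℕ) (r : ℝ) : ℝ :=
  if m = 2 then (Real.log 2 - Real.eulerMascheroniConstant - Real.log r) * r
  else r / ((m : ℝ) - 2)

/-- The bracket `[a]_2`: a factor that is present only in dimension `m = 2`. -/
def bracketTwo (m : ℕ) (a : ℝ) : ℝ := if m = 2 then a else 1

/-- The remainder `R'_m(r, η) = C(∂B_r, B_η)² - m r^(m-1) / η^m - h_m(r)`. -/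
def remainder (m : ℕ) (r η : ℝ) : ℝ :=
  (optTraceConst m r η).toReal ^ 2 - (m : ℝ) * r ^ (m - 1) / η ^ m - hTerm m r

end

end SobolevTrace

namespace SobolevTrace

/-! ### Bounds for Euler's constant -/

/-! The trace constant is computed exactly. Let `f = radialSol m` be the regular radial solution of
`Δu = u` and let `g = f N`, with `N = radialQuot m η`, be the radial solution with zero normal
derivative at radius `η`. Then `C(∂B_r, B_η)² = r^(m-1) f(r)² N(r)`, which is `traceConstSq`
(`optTraceConst_eq`).

Upper bound: on each ray only the radial derivative is kept. The function `P = s^(m-1) w`, with `w =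
f'/f` inside radius `r` and `w = g'/g` outside, satisfies the Riccati equation `P' = s^(m-1)(1 -
w²)`, so the energy density minus `(P|v|²)'` is a weighted square. The boundary terms at `0` and `η`
vanish, and the jump of `P` at `r` is `1/(f²N)` (`ray_trace_inequality`). Integration over the
sphere gives the bound for smooth functions; the definition of the trace carries it to `H¹`.

Lower bound: the extremal `f(s) N(max(s, r))` has a kink at `r`. Switching on `N'` smoothly between
`r` and `d` gives smooth competitors, and `d → r` loses nothing (`energy_testProfile_le`,
`le_optTraceConst_of_lt`).

Monotonicity: the derivative of `C²` is a nonnegative term plus a positive multiple of `g' +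
(m-1)g/s`. That quantity decreases on `(0, 1]` because of the equation for `g`, and it is
nonnegative at `η`.

Asymptotics: since `f = 1 + O(s²)`, `N(r)` is close to `m/η^m + ∫_r^η t^(1-m) dt`, whose second term
produces `h_m`. For `m = 2` the summand `(log 2 - γ) r` lies within the allowed error, so only `0 ≤
log 2 - γ ≤ 1` matters there; the sharper numerical bounds are a separate claim. -/

theorem log_succ_div_le_trapezoid {x : ℝ} (hx : 0 < x) :
    Real.log ((x + 1) / x) ≤ (1 / x + 1 / (x + 1)) / 2 := by
  have h := Real.log_div_le_sum_range_add (x := 1 / (2 * x + 1)) (by positivity)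
    (by rw [div_lt_one (by positivity)]; linarith) 1
  have e1 : (1 + 1 / (2 * x + 1)) / (1 - 1 / (2 * x + 1)) = (x + 1) / x := by
    have : 1 - 1 / (2 * x + 1) = 2 * x / (2 * x + 1) := by field_simp; ring
    rw [this]; field_simp; ring
  have e2 : 1 / (2 * x + 1) + (1 / (2 * x + 1)) ^ 3 / (1 - (1 / (2 * x + 1)) ^ 2)
      = (1 / x + 1 / (x + 1)) / 4 := by
    have : 1 - (1 / (2 * x + 1)) ^ 2 = 4 * x * (x + 1) / (2 * x + 1) ^ 2 := by field_simp; ring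
    rw [this]; field_simp; ring
  rw [e1] at h
  simp only [Finset.range_one, Finset.sum_singleton, mul_zero, zero_add, pow_one,
    Nat.cast_zero, div_one, mul_one] at h
  norm_num at h e2
  norm_num
  linarith

theorem one_div_le_log_midpoint {x : ℝ} (hx : 1 ≤ x) :
    1 / x ≤ Real.log ((x + 1 / 2) / (x - 1 / 2)) := by
  have h := Real.sum_range_le_log_div (x := 1 / (2 * x)) (by positivity)
    (by rw [div_lt_one (by positivity)]; linarith) 1
  have e1 : (1 + 1 / (2 * x)) / (1 - 1 / (2 * x)) = (x + 1 / 2) / (x - 1 / 2) := by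
    have : 1 - 1 / (2 * x) = (x - 1 / 2) / x := by field_simp
    rw [this]; field_simp
  rw [e1] at h
  have e2 : 1 / (2 * x) = (1 / x) / 2 := by field_simp
  simp only [Finset.range_one, Finset.sum_singleton, mul_zero, zero_add, pow_one,
    Nat.cast_zero, div_one] at h
  linarith

/-- The trapezoidal bound makes `H_n - log n - 1/(2n)` increasing in `n`, with limit `γ`. -/
theorem harmonic_sub_le_eulerMascheroniConstant {n : ℕ} (hn : n ≠ 0) :
    (harmonic n : ℝ) - Real.log n - 1 / (2 * n) ≤ Real.eulerMascheroniConstant := by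
  have hmono : ∀ k : ℕ, (harmonic n : ℝ) - Real.log n - 1 / (2 * n) ≤
      (harmonic (n + k) : ℝ) - Real.log (n + k : ℕ) := by
    suffices ∀ k : ℕ, (harmonic n : ℝ) - Real.log n - 1 / (2 * n) ≤
        (harmonic (n + k) : ℝ) - Real.log (n + k : ℕ) - 1 / (2 * (n + k : ℕ)) by
      intro k
      have h0 : (0 : ℝ) ≤ 1 / (2 * (n + k : ℕ)) := by positivity
      linarith [this k]
    intro k
    induction k with
    | zero => simp
    | succ k ih =>
      refine ih.trans ?_
      have hpos : (0 : ℝ) < (n + k : ℕ) := by exact_mod_cast (by omega)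
      have h := log_succ_div_le_trapezoid hpos
      rw [Real.log_div (by positivity) (by positivity)] at h
      rw [← add_assoc, harmonic_succ]
      push_cast at h hpos ⊢
      have e1 : 1 / (2 * ((n : ℝ) + k)) = (1 / ((n : ℝ) + k)) / 2 := by field_simp
      have e2 : 1 / (2 * ((n : ℝ) + k + 1)) = (1 / ((n : ℝ) + k + 1)) / 2 := by field_simp
      rw [e1, e2, inv_eq_one_div]
      linarith
  refine ge_of_tendsto ((Real.tendsto_harmonic_sub_log).comp (tendsto_add_atTop_nat n))
    (Eventually.of_forall fun k => ?_)
  have := hmono k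
  rw [add_comm n k] at this
  exact this

/-- The midpoint bound makes `H_n - log (n + 1/2)` decreasing in `n`, with limit `γ`. -/
theorem eulerMascheroniConstant_le_harmonic_sub (n : ℕ) :
    Real.eulerMascheroniConstant ≤ (harmonic n : ℝ) - Real.log (n + 1 / 2) := by
  have hanti : ∀ k : ℕ, (harmonic (n + k) : ℝ) - Real.log ((n + k : ℕ) + 1 / 2) ≤
      (harmonic n : ℝ) - Real.log (n + 1 / 2) := by
    intro k
    induction k with
    | zero => simp
    | succ k ih =>
      refine le_trans ?_ ih
      have h := one_div_le_log_midpoint (x := (n + k : ℕ) + 1) (by simp; positivity)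
      have e : ((n + k : ℕ) : ℝ) + 1 - 1 / 2 = (n + k : ℕ) + 1 / 2 := by ring
      rw [e, Real.log_div (by positivity) (by positivity)] at h
      rw [← add_assoc, harmonic_succ]
      push_cast at h ⊢
      rw [inv_eq_one_div]
      linarith
  have hlim : Tendsto (fun k : ℕ => (harmonic k : ℝ) - Real.log ((k : ℝ) + 1 / 2)) atTop
      (𝓝 Real.eulerMascheroniConstant) := by
    have h1 := (Real.tendsto_log_comp_add_sub_log (1 / 2)).comp tendsto_natCast_atTop_atTop
    have h2 := Real.tendsto_harmonic_sub_log.sub h1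
    simp only [sub_zero] at h2
    refine h2.congr fun k => ?_
    simp
  refine le_of_tendsto (hlim.comp (tendsto_add_atTop_nat n)) (Eventually.of_forall fun k => ?_)
  have := hanti k
  rw [add_comm n k] at this
  exact this

theorem log_two_sub_eulerMascheroniConstant_bounds :
    0.115 < Real.log 2 - Real.eulerMascheroniConstant ∧
      Real.log 2 - Real.eulerMascheroniConstant < 0.116 := by
  -- Powers of two reduce the logarithms to `log 2`, up to `log (33/32)`; the sizes `64` and `16`
  -- are large enough for the two margins.
  have h1 := harmonic_sub_le_eulerMascheroniConstant (n := 64) (by norm_num)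
  have h2 := eulerMascheroniConstant_le_harmonic_sub 16
  have e1 : Real.log ((64 : ℕ) : ℝ) = 6 * Real.log 2 := by
    rw [show ((64 : ℕ) : ℝ) = 2 ^ 6 by norm_num, Real.log_pow]; norm_num
  have e2 : Real.log (((16 : ℕ) : ℝ) + 1 / 2) = 4 * Real.log 2 + Real.log (33 / 32) := by
    rw [show ((16 : ℕ) : ℝ) + 1 / 2 = 2 ^ 4 * (33 / 32) by norm_num,
      Real.log_mul (by norm_num) (by norm_num), Real.log_pow]; norm_num
  have h3 : (2 / 65 : ℝ) ≤ Real.log (33 / 32) := by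
    have h := one_div_le_log_midpoint (x := 65 / 2) (by norm_num)
    norm_num at h
    exact h
  rw [e1] at h1
  rw [e2] at h2
  have l1 := Real.log_two_gt_d9
  have l2 := Real.log_two_lt_d9
  norm_num at h1 h2 l1 l2 ⊢
  constructor <;> linarith

/-! ### The radial solution of `Δu = u` that is regular at the origin -/

/-- The coefficients of the power series `besselSeries m`. -/
noncomputable def besselCoeff (m : ℕ) : ℕ → ℝ
  | 0 => 1
  | n + 1 => besselCoeff m n / (2 * ((n : ℝ) + 1) * (2 * n + m))

/-- The power series `Φ_m` for which `x ↦ Φ_m(‖x‖²)` solves `Δu = u` in `ℝ^m`. -/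
noncomputable def besselSeries (m : ℕ) (t : ℝ) : ℝ := ∑' n, besselCoeff m n * t ^ n

variable {m : ℕ}

theorem besselCoeff_pos (hm : 0 < m) (n : ℕ) : 0 < besselCoeff m n := by
  induction n with
  | zero => simp [besselCoeff]
  | succ n ih => rw [besselCoeff]; positivity

theorem besselCoeff_le (hm : 0 < m) (n : ℕ) : besselCoeff m n ≤ 1 / (n.factorial : ℝ) := by
  induction n with
  | zero => simp [besselCoeff]
  | succ n ih =>
    have hm' : (1 : ℝ) ≤ m := by exact_mod_cast hm
    rw [besselCoeff, Nat.factorial_succ, Nat.cast_mul, div_le_div_iff₀ (by positivity)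
      (by positivity)]
    rw [le_div_iff₀ (by positivity)] at ih
    push_cast
    have h1 : 0 ≤ ((n : ℝ) + 1) := by positivity
    have h0 : (0 : ℝ) ≤ n := by positivity
    nlinarith

/-- Coefficient form of `Φ_m' = Φ_{m+2} / (2m)`: differentiation stays inside the family, which
gives smoothness by induction and the derivative of `f` in closed form. -/
theorem succ_mul_besselCoeff_succ (hm : 0 < m) (n : ℕ) :
    ((n : ℝ) + 1) * besselCoeff m (n + 1) = besselCoeff (m + 2) n / (2 * m) := by
  induction n with
  | zero => simp [besselCoeff]
  | succ n ih =>
    have hm' : (0 : ℝ) < m := by exact_mod_cast hm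
    rw [besselCoeff, besselCoeff.eq_2 (m + 2)]
    have : besselCoeff m (n + 1) = besselCoeff (m + 2) n / (2 * m) / (n + 1) := by
      rw [← ih]; field_simp
    rw [this]
    push_cast
    field_simp
    ring

theorem besselCoeff_succ_eq (hm : 0 < m) (n : ℕ) :
    besselCoeff m (n + 1) =
      besselCoeff (m + 2) (n + 1) + besselCoeff (m + 4) n / (m * (m + 2)) := by
  have h1 := succ_mul_besselCoeff_succ hm n
  have h2 := succ_mul_besselCoeff_succ (m := m + 2) (by omega) n
  have h3 : besselCoeff (m + 2) (n + 1) = _ := besselCoeff.eq_2 (m + 2) n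
  have hm' : (0 : ℝ) < m := by exact_mod_cast hm
  push_cast at h2 h3
  have e1 : besselCoeff m (n + 1) = besselCoeff (m + 2) n / (2 * m) / (n + 1) := by
    rw [← h1]; field_simp
  have e2 : besselCoeff (m + 4) n = ((n : ℝ) + 1) * besselCoeff (m + 2) (n + 1) * (2 * (m + 2)) := by
    rw [h2]; field_simp
  rw [e1, e2, h3]
  field_simp
  ring

theorem summable_besselCoeff_mul_pow (hm : 0 < m) (t : ℝ) :
    Summable fun n => besselCoeff m n * t ^ n := by
  refine Summable.of_norm_bounded (Real.summable_pow_div_factorial |t|) fun n => ?_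
  rw [norm_mul, norm_pow, Real.norm_eq_abs, Real.norm_eq_abs, abs_of_pos (besselCoeff_pos hm n),
    div_eq_mul_one_div, mul_comm]
  gcongr
  exact besselCoeff_le hm n

theorem hasDerivAt_besselSeries (hm : 0 < m) (t : ℝ) :
    HasDerivAt (besselSeries m) (besselSeries (m + 2) t / (2 * m)) t := by
  have hm' : (0 : ℝ) < m := by exact_mod_cast hm
  have hshift : ∀ (x : ℝ) (n : ℕ), besselCoeff m (n + 1) * (((n + 1 : ℕ) : ℝ) * x ^ (n + 1 - 1)) =
      besselCoeff (m + 2) n * x ^ n / (2 * m) := by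
    intro x n
    have := succ_mul_besselCoeff_succ hm n
    rw [Nat.add_sub_cancel, mul_div_right_comm, ← this]
    push_cast
    ring
  have hsum : ∀ x : ℝ, Summable fun n : ℕ => besselCoeff m n * ((n : ℝ) * x ^ (n - 1)) := by
    intro x
    rw [← summable_nat_add_iff 1]
    simp only [hshift]
    exact (summable_besselCoeff_mul_pow (by omega) x).div_const _
  have h := hasDerivAt_tsum_of_isPreconnected (g := fun n x => besselCoeff m n * x ^ n)
    (g' := fun n x => besselCoeff m n * ((n : ℝ) * x ^ (n - 1)))
    (hsum (|t| + 1)) Metric.isOpen_ball (convex_ball (0 : ℝ) (|t| + 1)).isPreconnected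
    (fun n y _ => (hasDerivAt_pow n y).const_mul _)
    (fun n y hy => by
      rw [norm_mul, norm_mul, norm_pow, Real.norm_eq_abs, Real.norm_eq_abs, Real.norm_eq_abs,
        abs_of_pos (besselCoeff_pos hm n), Nat.abs_cast]
      have hy' : |y| ≤ |t| + 1 := by
        rw [Metric.mem_ball, dist_zero_right, Real.norm_eq_abs] at hy; exact hy.le
      have := (besselCoeff_pos hm n).le
      gcongr)
    (y₀ := 0) (y := t) (by simp; positivity) (summable_besselCoeff_mul_pow hm 0)
    (by simp)
  refine h.congr_deriv ?_
  rw [(hsum t).tsum_eq_zero_add]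
  simp only [hshift]
  rw [tsum_div_const]
  simp [besselSeries]

theorem contDiff_besselSeries (hm : 0 < m) : ContDiff ℝ ∞ (besselSeries m) := by
  rw [contDiff_infty]
  intro n
  induction n generalizing m with
  | zero =>
    exact contDiff_zero.2 (continuous_iff_continuousAt.2 fun t =>
      (hasDerivAt_besselSeries hm t).continuousAt)
  | succ n ih =>
    push_cast
    rw [contDiff_succ_iff_deriv]
    refine ⟨fun t => (hasDerivAt_besselSeries hm t).differentiableAt, by simp, ?_⟩
    have : deriv (besselSeries m) = fun t => besselSeries (m + 2) t / (2 * m) :=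
      funext fun t => (hasDerivAt_besselSeries hm t).deriv
    rw [this]
    exact (ih (by omega)).div_const _

/-- This contiguity relation is the differential equation for `Φ_m` once both derivatives are
rewritten as `Φ_{m+2}` and `Φ_{m+4}`. -/
theorem besselSeries_eq (hm : 0 < m) (t : ℝ) :
    besselSeries m t =
      besselSeries (m + 2) t + t / (m * (m + 2)) * besselSeries (m + 4) t := by
  have s2 := summable_besselCoeff_mul_pow (m := m + 2) (by omega) t
  have s4 := summable_besselCoeff_mul_pow (m := m + 4) (by omega) t
  rw [besselSeries, besselSeries, besselSeries,
    (summable_besselCoeff_mul_pow hm t).tsum_eq_zero_add, s2.tsum_eq_zero_add, ← tsum_mul_left,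
    add_assoc, ← Summable.tsum_add ((summable_nat_add_iff 1).2 s2) (s4.mul_left _)]
  refine congrArg₂ (· + ·) ?_ (tsum_congr fun n => ?_)
  · simp [besselCoeff]
  · rw [besselCoeff_succ_eq hm n, pow_succ]
    ring

theorem one_le_besselSeries (hm : 0 < m) {t : ℝ} (ht : 0 ≤ t) : 1 ≤ besselSeries m t := by
  rw [besselSeries, (summable_besselCoeff_mul_pow hm t).tsum_eq_zero_add]
  have : 0 ≤ ∑' n, besselCoeff m (n + 1) * t ^ (n + 1) :=
    tsum_nonneg fun n => mul_nonneg (besselCoeff_pos hm _).le (by positivity)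
  simpa [besselCoeff] using this

theorem besselSeries_le (hm : 0 < m) {t : ℝ} (ht : 0 ≤ t) (ht1 : t ≤ 1) :
    besselSeries m t ≤ 1 + 2 * t := by
  have h1 : besselSeries m t ≤ Real.exp t := by
    rw [Real.exp_eq_exp_ℝ, NormedSpace.exp_eq_tsum_div]
    refine Summable.tsum_le_tsum (fun n => ?_) (summable_besselCoeff_mul_pow hm t)
      (Real.summable_pow_div_factorial t)
    rw [div_eq_mul_one_div, mul_comm]
    gcongr
    exact besselCoeff_le hm n
  have h2 : Real.exp t ≤ 1 + 2 * t := by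
    have h := Real.abs_exp_sub_one_le (x := t) (by rwa [abs_of_nonneg ht])
    rw [abs_of_nonneg ht] at h
    linarith [le_abs_self (Real.exp t - 1)]
  exact h1.trans h2

/-- The radial profile `f_m(s) = Φ_m(s²)`. -/
noncomputable def radialSol (m : ℕ) (s : ℝ) : ℝ := besselSeries m (s ^ 2)

theorem hasDerivAt_radialSol (hm : 0 < m) (s : ℝ) :
    HasDerivAt (radialSol m) (s / m * radialSol (m + 2) s) s := by
  have hm' : (0 : ℝ) < m := by exact_mod_cast hm
  have h := (hasDerivAt_besselSeries hm (s ^ 2)).comp s (hasDerivAt_pow 2 s)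
  refine h.congr_deriv ?_
  rw [radialSol]
  field_simp
  norm_num
  ring

theorem continuous_radialSol (hm : 0 < m) : Continuous (radialSol m) :=
  continuous_iff_continuousAt.2 fun s => (hasDerivAt_radialSol hm s).continuousAt

theorem radialSol_pos (hm : 0 < m) (s : ℝ) : 0 < radialSol m s :=
  one_pos.trans_le (one_le_besselSeries hm (sq_nonneg s))

theorem one_le_radialSol (hm : 0 < m) (s : ℝ) : 1 ≤ radialSol m s :=
  one_le_besselSeries hm (sq_nonneg s)

theorem radialSol_le (hm : 0 < m) {s : ℝ} (h0 : 0 ≤ s) (h1 : s ≤ 1) :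
    radialSol m s ≤ 1 + 2 * s ^ 2 :=
  besselSeries_le hm (sq_nonneg s) (by nlinarith)

/-- The radial equation `(s^(m-1) f')' = s^(m-1) f`. -/
theorem hasDerivAt_pow_mul_radialSol (hm : 0 < m) (s : ℝ) :
    HasDerivAt (fun s => s ^ m / m * radialSol (m + 2) s) (s ^ (m - 1) * radialSol m s) s := by
  have hm' : (0 : ℝ) < m := by exact_mod_cast hm
  have h := ((hasDerivAt_pow m s).div_const (m : ℝ)).mul (hasDerivAt_radialSol (m := m + 2)
    (by omega) s)
  refine h.congr_deriv ?_
  have e := besselSeries_eq hm (s ^ 2)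
  obtain ⟨k, rfl⟩ : ∃ k, m = k + 1 := ⟨m - 1, by omega⟩
  simp only [radialSol, Nat.add_sub_cancel] at e ⊢
  rw [e]
  push_cast at hm' ⊢
  have : (k : ℝ) + 1 + 2 ≠ 0 := by positivity
  field_simp
  ring

/-! ### The radial variational problem -/

/-- The flux `s^(m-1) f'(s)` of the regular radial solution. -/
noncomputable def radialFlux (m : ℕ) (s : ℝ) : ℝ := s ^ m / m * radialSol (m + 2) s

/-- `s ↦ radialQuot m η s` is the quotient of the radial solution with zero normal derivative
at radius `η` by the regular radial solution. -/
noncomputable def radialQuot (m : ℕ) (η s : ℝ) : ℝ :=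
  1 / (radialSol m η * radialFlux m η) + ∫ t in s..η, 1 / (t ^ (m - 1) * radialSol m t ^ 2)

/-- The square of the optimal trace constant. -/
noncomputable def traceConstSq (m : ℕ) (η r : ℝ) : ℝ :=
  r ^ (m - 1) * radialSol m r ^ 2 * radialQuot m η r

theorem hasDerivAt_radialFlux (hm : 0 < m) (s : ℝ) :
    HasDerivAt (radialFlux m) (s ^ (m - 1) * radialSol m s) s :=
  hasDerivAt_pow_mul_radialSol hm s

theorem radialFlux_pos (hm : 0 < m) {s : ℝ} (hs : 0 < s) : 0 < radialFlux m s := by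
  have := radialSol_pos (m := m + 2) (by omega) s
  rw [radialFlux]
  positivity

theorem radialFlux_eq (hm : 0 < m) (s : ℝ) :
    radialFlux m s = s ^ (m - 1) * (s / m * radialSol (m + 2) s) := by
  obtain ⟨k, rfl⟩ : ∃ k, m = k + 1 := ⟨m - 1, by omega⟩
  rw [radialFlux, Nat.add_sub_cancel, pow_succ]
  ring

theorem continuousOn_quotIntegrand (hm : 0 < m) :
    ContinuousOn (fun t : ℝ => 1 / (t ^ (m - 1) * radialSol m t ^ 2)) (Ioi 0) := by
  refine continuousOn_const.div
    ((continuous_pow _).mul ((continuous_radialSol hm).pow 2)).continuousOn fun t ht => ?_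
  have := radialSol_pos hm t
  have ht' : 0 < t := ht
  positivity

theorem intervalIntegrable_quotIntegrand (hm : 0 < m) {a b : ℝ} (ha : 0 < a) (hb : 0 < b) :
    IntervalIntegrable (fun t : ℝ => 1 / (t ^ (m - 1) * radialSol m t ^ 2)) volume a b :=
  ((continuousOn_quotIntegrand hm).mono fun _ ht =>
    (lt_min ha hb).trans_le ht.1).intervalIntegrable

theorem hasDerivAt_radialQuot (hm : 0 < m) {η s : ℝ} (hη : 0 < η) (hs : 0 < s) :
    HasDerivAt (radialQuot m η) (-(1 / (s ^ (m - 1) * radialSol m s ^ 2))) s := by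
  have hc := (continuousOn_quotIntegrand hm).continuousAt (Ioi_mem_nhds hs)
  exact (intervalIntegral.integral_hasDerivAt_left (intervalIntegrable_quotIntegrand hm hs hη)
    ((continuousOn_quotIntegrand hm).stronglyMeasurableAtFilter isOpen_Ioi _ hs) hc).const_add _

theorem radialQuot_self (m : ℕ) (η : ℝ) :
    radialQuot m η η = 1 / (radialSol m η * radialFlux m η) := by
  simp [radialQuot]

theorem radialQuot_pos (hm : 0 < m) {η s : ℝ} (hs : 0 < s) (hsη : s ≤ η) :
    0 < radialQuot m η s := by
  have h1 := radialSol_pos hm η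
  have h2 := radialFlux_pos hm (hs.trans_le hsη)
  refine add_pos_of_pos_of_nonneg (by positivity)
    (intervalIntegral.integral_nonneg hsη fun t ht => ?_)
  have := hs.trans_le ht.1
  positivity

theorem traceConstSq_pos (hm : 0 < m) {η r : ℝ} (hr : 0 < r) (hrη : r ≤ η) :
    0 < traceConstSq m η r := by
  have h1 := radialSol_pos hm r
  have h2 := radialQuot_pos hm hr hrη
  rw [traceConstSq]
  positivity

/-- A supersolution of the radial Riccati equation bounds the energy on an interval from below. -/
theorem riccati_le_energy {a b : ℝ} (ha : 0 ≤ a) (hab : a ≤ b) {P w : ℝ → ℝ} {v v' : ℝ → ℂ}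
    (k : ℕ) (hw : ContinuousOn w (Icc a b))
    (hPw : ∀ s ∈ Icc a b, P s = s ^ k * w s)
    (hP : ∀ s ∈ Icc a b, HasDerivAt P (s ^ k * (1 - w s ^ 2)) s)
    (hv : ∀ s, HasDerivAt v (v' s) s) (hv' : Continuous v') :
    P b * ‖v b‖ ^ 2 - P a * ‖v a‖ ^ 2 ≤ ∫ s in a..b, s ^ k * (‖v s‖ ^ 2 + ‖v' s‖ ^ 2) := by
  have hvc : Continuous v := continuous_iff_continuousAt.2 fun s => (hv s).continuousAt
  have hd : ∀ s ∈ uIcc a b, HasDerivAt (fun s => P s * ‖v s‖ ^ 2)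
      (s ^ k * (1 - w s ^ 2) * ‖v s‖ ^ 2 + P s * (2 * inner ℝ (v s) (v' s))) s := by
    intro s hs
    rw [uIcc_of_le hab] at hs
    exact (hP s hs).mul (hv s).norm_sq
  have hPc : ContinuousOn P (Icc a b) := fun s hs => (hP s hs).continuousAt.continuousWithinAt
  have hint : IntervalIntegrable (fun s =>
      s ^ k * (1 - w s ^ 2) * ‖v s‖ ^ 2 + P s * (2 * inner ℝ (v s) (v' s))) volume a b := by
    refine ContinuousOn.intervalIntegrable ?_
    rw [uIcc_of_le hab]
    have h1 : Continuous fun s => inner ℝ (v s) (v' s) := hvc.inner hv'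
    fun_prop
  rw [← intervalIntegral.integral_eq_sub_of_hasDerivAt hd hint]
  refine intervalIntegral.integral_mono_on hab hint
    (Continuous.intervalIntegrable (by fun_prop) _ _) fun s hs => ?_
  rw [hPw s hs]
  have hs0 : 0 ≤ s ^ k := pow_nonneg (ha.trans hs.1) _
  -- Completing the square: the two integrands differ by `s^k ‖v' - w v‖² ≥ 0`.
  have h := norm_sub_sq_real (v' s) (w s • v s)
  rw [inner_smul_right, real_inner_comm, norm_smul, mul_pow, Real.norm_eq_abs, sq_abs] at h
  have h2 := mul_nonneg hs0 (sq_nonneg ‖v' s - w s • v s‖)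
  rw [h] at h2
  linarith

/-- The sharp trace inequality on a ray. -/
theorem ray_trace_inequality (hm : 2 ≤ m) {r η : ℝ} (hr : 0 < r) (hrη : r < η) {v v' : ℝ → ℂ}
    (hv : ∀ s, HasDerivAt v (v' s) s) (hv' : Continuous v') :
    r ^ (m - 1) * ‖v r‖ ^ 2 ≤
      traceConstSq m η r * ∫ s in (0 : ℝ)..η, s ^ (m - 1) * (‖v s‖ ^ 2 + ‖v' s‖ ^ 2) := by
  have hm0 : 0 < m := by omega
  have hη := hr.trans hrη
  have hvc : Continuous v := continuous_iff_continuousAt.2 fun s => (hv s).continuousAt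
  have hm' : (0 : ℝ) < m := by exact_mod_cast hm0
  have hf := fun s => radialSol_pos hm0 s
  have hf0 := fun s => (radialSol_pos hm0 s).ne'
  have hc2 := continuous_radialSol (m := m + 2) (by omega)
  have hc0 := continuous_radialSol hm0
  have hPd : ∀ s, HasDerivAt (fun s => radialFlux m s / radialSol m s)
      (s ^ (m - 1) * (1 - (s / m * radialSol (m + 2) s / radialSol m s) ^ 2)) s := by
    intro s
    refine ((hasDerivAt_radialFlux hm0 s).div (hasDerivAt_radialSol hm0 s) (hf0 s)).congr_deriv ?_
    rw [radialFlux_eq hm0]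
    field_simp [hf0 s]
  have hwc : Continuous fun s => s / m * radialSol (m + 2) s / radialSol m s :=
    (((continuous_id.div_const _).mul hc2).div hc0 hf0)
  -- Inside radius `r`, the logarithmic derivative `f'/f`; its flux vanishes at `0`.
  have h1 := riccati_le_energy (v := v) (v' := v') le_rfl hr.le (m - 1)
    (P := fun s => radialFlux m s / radialSol m s) hwc.continuousOn
    (fun s _ => by rw [radialFlux_eq hm0]; ring) (fun s _ => hPd s) hv hv'
  have hN := fun s (hs : s ∈ Icc r η) => radialQuot_pos hm0 (hr.trans_le hs.1) hs.2
  -- Outside radius `r`, the logarithmic derivative of `f N`; its flux vanishes at `η` by the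
  -- Neumann condition.
  have h2 := riccati_le_energy (v := v) (v' := v') hr.le hrη.le (m - 1)
    (P := fun s => radialFlux m s / radialSol m s - 1 / (radialSol m s ^ 2 * radialQuot m η s))
    (w := fun s => s / m * radialSol (m + 2) s / radialSol m s -
      1 / (s ^ (m - 1) * radialSol m s ^ 2) / radialQuot m η s) ?_ ?_ ?_ hv hv'
  · have hsum := intervalIntegral.integral_add_adjacent_intervals (μ := volume) (a := 0) (b := r)
      (c := η) (f := fun s => s ^ (m - 1) * (‖v s‖ ^ 2 + ‖v' s‖ ^ 2))
      (Continuous.intervalIntegrable (by fun_prop) _ _)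
      (Continuous.intervalIntegrable (by fun_prop) _ _)
    have hNr := hN r ⟨le_rfl, hrη.le⟩
    have hF0 : radialFlux m 0 = 0 := by simp [radialFlux, hm0.ne']
    have hFη := radialFlux_pos hm0 hη
    have hη0 : radialFlux m η / radialSol m η - 1 / (radialSol m η ^ 2 * radialQuot m η η) = 0 := by
      rw [radialQuot_self]
      have := hf0 η
      field_simp
      ring
    simp only [hF0, hη0, zero_div, zero_mul, sub_zero, zero_sub] at h1 h2
    -- Adding the two estimates leaves only the jump of the fluxes at `r`.
    have h3 : 1 / (radialSol m r ^ 2 * radialQuot m η r) * ‖v r‖ ^ 2 ≤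
        ∫ s in (0 : ℝ)..η, s ^ (m - 1) * (‖v s‖ ^ 2 + ‖v' s‖ ^ 2) := by
      rw [← hsum]
      linarith
    have hfr := hf r
    calc r ^ (m - 1) * ‖v r‖ ^ 2
        = traceConstSq m η r * (1 / (radialSol m r ^ 2 * radialQuot m η r) * ‖v r‖ ^ 2) := by
          rw [traceConstSq]; field_simp
      _ ≤ _ := by
          have := traceConstSq_pos hm0 hr hrη.le
          gcongr
  · refine hwc.continuousOn.sub (((continuousOn_quotIntegrand hm0).mono fun s hs =>
      hr.trans_le hs.1).div (fun s hs => ?_) fun s hs => (hN s hs).ne')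
    exact (hasDerivAt_radialQuot hm0 hη (hr.trans_le hs.1)).continuousAt.continuousWithinAt
  · intro s hs
    have hs0 := hr.trans_le hs.1
    have := hf0 s
    have := hN s hs
    rw [radialFlux_eq hm0]
    field_simp
  · intro s hs
    have hs0 := hr.trans_le hs.1
    have h0 := hf0 s
    have hn := (hN s hs).ne'
    refine ((hPd s).sub ((hasDerivAt_const s (1 : ℝ)).div
      (((hasDerivAt_radialSol hm0 s).pow 2).mul (hasDerivAt_radialQuot hm0 hη hs0))
      (by simp; exact ⟨h0, hn⟩))).congr_deriv ?_
    simp only [Pi.mul_apply, Pi.pow_apply]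
    field_simp
    ring

/-- The density of the truncated quotient, as a function of the squared radius. -/
noncomputable def cutoffDensity (m : ℕ) (r d t : ℝ) : ℝ :=
  Real.smoothTransition ((t - r ^ 2) / (d ^ 2 - r ^ 2)) /
    (2 * Real.sqrt t ^ m * besselSeries m t ^ 2)

/-- A smooth truncation of `radialQuot`, as a function of the squared radius. -/
noncomputable def cutoffQuot (m : ℕ) (r d η t : ℝ) : ℝ :=
  1 / (radialSol m η * radialFlux m η) + ∫ τ in t..η ^ 2, cutoffDensity m r d τ

theorem cutoffDensity_eq_zero {r d t : ℝ} (hr : 0 < r) (hrd : r < d) (ht : t ≤ r ^ 2) :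
    cutoffDensity m r d t = 0 := by
  rw [cutoffDensity, Real.smoothTransition.zero_of_nonpos, zero_div]
  exact div_nonpos_of_nonpos_of_nonneg (by linarith) (by nlinarith)

theorem contDiff_cutoffDensity (hm : 0 < m) {r d : ℝ} (hr : 0 < r) (hrd : r < d) :
    ContDiff ℝ ∞ (cutoffDensity m r d) := by
  rw [contDiff_iff_contDiffAt]
  intro t
  rcases lt_or_ge t (r ^ 2) with ht | ht
  · refine contDiffAt_const (c := (0 : ℝ)) |>.congr_of_eventuallyEq ?_
    filter_upwards [Iio_mem_nhds ht] with s hs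
    exact cutoffDensity_eq_zero hr hrd (le_of_lt hs)
  · have ht0 : 0 < t := (by positivity : 0 < r ^ 2).trans_le ht
    have h1 : ContDiffAt ℝ ∞ (fun t => (t - r ^ 2) / (d ^ 2 - r ^ 2)) t := by fun_prop
    have h2 : ContDiffAt ℝ ∞ Real.sqrt t := Real.contDiffAt_sqrt ht0.ne'
    have h3 := (contDiff_besselSeries hm).contDiffAt (x := t)
    refine (Real.smoothTransition.contDiffAt.comp t h1).div
      ((contDiffAt_const.mul (h2.pow m)).mul (h3.pow 2)) ?_
    have := one_pos.trans_le (one_le_besselSeries hm ht0.le)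
    have := Real.sqrt_pos.2 ht0
    positivity

theorem hasDerivAt_cutoffQuot (hm : 0 < m) {r d : ℝ} (η : ℝ) (hr : 0 < r) (hrd : r < d) (t : ℝ) :
    HasDerivAt (cutoffQuot m r d η) (-cutoffDensity m r d t) t := by
  have hc := (contDiff_cutoffDensity hm hr hrd).continuous
  exact (intervalIntegral.integral_hasDerivAt_left (hc.intervalIntegrable _ _)
    hc.stronglyMeasurable.stronglyMeasurableAtFilter hc.continuousAt).const_add _

theorem contDiff_cutoffQuot (hm : 0 < m) {r d : ℝ} (η : ℝ) (hr : 0 < r) (hrd : r < d) :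
    ContDiff ℝ ∞ (cutoffQuot m r d η) := by
  rw [contDiff_infty_iff_deriv]
  refine ⟨fun t => (hasDerivAt_cutoffQuot hm η hr hrd t).differentiableAt, ?_⟩
  rw [funext fun t => (hasDerivAt_cutoffQuot hm η hr hrd t).deriv]
  exact (contDiff_cutoffDensity hm hr hrd).neg

/-- The factor `2s` comes from `t = s²`: in the radius variable the density is `-N'` times a cutoff.
Working with `t` keeps the radial competitor smooth at the origin. -/
theorem two_mul_cutoffDensity_sq (hm : 0 < m) (r d : ℝ) {s : ℝ} (hs : 0 < s) :
    2 * s * cutoffDensity m r d (s ^ 2) =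
      Real.smoothTransition ((s ^ 2 - r ^ 2) / (d ^ 2 - r ^ 2)) *
        (1 / (s ^ (m - 1) * radialSol m s ^ 2)) := by
  have h := radialSol_pos hm s
  rw [cutoffDensity, Real.sqrt_sq hs.le, ← radialSol]
  obtain ⟨k, rfl⟩ : ∃ k, m = k + 1 := ⟨m - 1, by omega⟩
  rw [Nat.add_sub_cancel]
  field_simp
  ring

theorem cutoffQuot_zero (m : ℕ) {r d : ℝ} (η : ℝ) (hm : 0 < m) (hr : 0 < r) (hrd : r < d) :
    cutoffQuot m r d η 0 = cutoffQuot m r d η (r ^ 2) := by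
  have hc := (contDiff_cutoffDensity hm hr hrd).continuous
  rw [cutoffQuot, cutoffQuot, ← intervalIntegral.integral_add_adjacent_intervals
    (hc.intervalIntegrable 0 (r ^ 2)) (hc.intervalIntegrable (r ^ 2) (η ^ 2))]
  have : ∫ τ in (0 : ℝ)..r ^ 2, cutoffDensity m r d τ = 0 := by
    rw [intervalIntegral.integral_congr (g := fun _ => (0 : ℝ))]
    · simp
    · intro τ hτ
      rw [uIcc_of_le (sq_nonneg r)] at hτ
      exact cutoffDensity_eq_zero hr hrd hτ.2
  rw [this, zero_add]

/-- The truncated quotient equals `N` beyond `d`, where the cutoff is `1` and both agree at `η`; it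
is nonincreasing between `r` and `d`. -/
theorem radialQuot_le_cutoffQuot (hm : 0 < m) {r d η : ℝ} (hr : 0 < r) (hrd : r < d) (hdη : d ≤ η) :
    radialQuot m η d ≤ cutoffQuot m r d η (r ^ 2) := by
  have hd := hr.trans hrd
  have hη := hd.trans_le hdη
  have hM : ∀ s, HasDerivAt (fun s => cutoffQuot m r d η (s ^ 2))
      (-(2 * s * cutoffDensity m r d (s ^ 2))) s := by
    intro s
    refine ((hasDerivAt_cutoffQuot hm η hr hrd (s ^ 2)).comp s (hasDerivAt_pow 2 s)).congr_deriv ?_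
    norm_num
    ring
  have hanti : AntitoneOn (fun s => cutoffQuot m r d η (s ^ 2)) (Icc r d) := by
    refine antitoneOn_of_hasDerivWithinAt_nonpos (convex_Icc _ _)
      (fun s _ => (hM s).continuousAt.continuousWithinAt) (fun s _ => (hM s).hasDerivWithinAt)
      fun s hs => ?_
    rw [interior_Icc] at hs
    have hs0 := hr.trans hs.1
    have := radialSol_pos hm s
    rw [two_mul_cutoffDensity_sq hm r d hs0, neg_nonpos]
    exact mul_nonneg (Real.smoothTransition.nonneg _) (by positivity)
  have heq : cutoffQuot m r d η (d ^ 2) = radialQuot m η d := by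
    have h : ∀ s ∈ uIcc d η, HasDerivAt (fun s => cutoffQuot m r d η (s ^ 2) - radialQuot m η s)
        0 s := by
      intro s hs
      rw [uIcc_of_le hdη] at hs
      have hs0 := hd.trans_le hs.1
      refine ((hM s).sub (hasDerivAt_radialQuot hm hη hs0)).congr_deriv ?_
      rw [two_mul_cutoffDensity_sq hm r d hs0, Real.smoothTransition.one_of_one_le]
      · ring
      · rw [one_le_div (by nlinarith)]
        nlinarith [hs.1]
    have h2 := intervalIntegral.integral_eq_sub_of_hasDerivAt h (by simp)
    rw [radialQuot_self] at h2
    simp only [intervalIntegral.integral_zero, cutoffQuot, intervalIntegral.integral_same] at h2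
    rw [cutoffQuot]
    linarith
  rw [← heq]
  exact hanti ⟨le_rfl, hrd.le⟩ ⟨hrd.le, le_rfl⟩ hrd.le

/-- The profile of an almost optimal radial function, as a function of the squared radius. -/
noncomputable def testProfile (m : ℕ) (r d η t : ℝ) : ℝ :=
  besselSeries m t * cutoffQuot m r d η t

theorem contDiff_testProfile (hm : 0 < m) {r d : ℝ} (η : ℝ) (hr : 0 < r) (hrd : r < d) :
    ContDiff ℝ ∞ (testProfile m r d η) :=
  (contDiff_besselSeries hm).mul (contDiff_cutoffQuot hm η hr hrd)

/-- With `M` the truncated quotient and `F` the flux, the energy density is at most `(F f M² - M)'`.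
The primitive vanishes at `η` and equals `-M(0) = -M(r)` at the origin. -/
theorem energy_testProfile_le (hm : 2 ≤ m) {r d η : ℝ} (hr : 0 < r) (hrd : r < d) (hdη : d ≤ η) :
    ∫ s in (0 : ℝ)..η, s ^ (m - 1) * (testProfile m r d η (s ^ 2) ^ 2 +
      (2 * s * deriv (testProfile m r d η) (s ^ 2)) ^ 2) ≤ cutoffQuot m r d η (r ^ 2) := by
  have hm0 : 0 < m := by omega
  have hm' : (0 : ℝ) < m := by exact_mod_cast hm0
  have hη : 0 < η := (hr.trans hrd).trans_le hdη
  have hP := contDiff_testProfile hm0 η hr hrd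
  have hPc := hP.continuous
  have hPd := hP.continuous_deriv (by simp)
  set M : ℝ → ℝ := fun s => cutoffQuot m r d η (s ^ 2) with hMdef
  have hM : ∀ s, HasDerivAt M (-(2 * s * cutoffDensity m r d (s ^ 2))) s := by
    intro s
    refine ((hasDerivAt_cutoffQuot hm0 η hr hrd (s ^ 2)).comp s (hasDerivAt_pow 2 s)).congr_deriv ?_
    norm_num
    ring
  have hderiv : ∀ s, 2 * s * deriv (testProfile m r d η) (s ^ 2) =
      s / m * radialSol (m + 2) s * M s -
        radialSol m s * (2 * s * cutoffDensity m r d (s ^ 2)) := by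
    intro s
    have h := ((hasDerivAt_besselSeries hm0 (s ^ 2)).mul
      (hasDerivAt_cutoffQuot hm0 η hr hrd (s ^ 2))).deriv
    have e : deriv (testProfile m r d η) (s ^ 2) = _ := h
    rw [e, hMdef]
    simp only [radialSol]
    field_simp
    ring
  have hT : ∀ s, HasDerivAt (fun s => radialFlux m s * radialSol m s * M s ^ 2 - M s)
      (s ^ (m - 1) * radialSol m s * radialSol m s * M s ^ 2 +
        radialFlux m s * (s / m * radialSol (m + 2) s) * M s ^ 2 -
        radialFlux m s * radialSol m s * (2 * M s * (2 * s * cutoffDensity m r d (s ^ 2))) +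
        2 * s * cutoffDensity m r d (s ^ 2)) s := by
    intro s
    refine ((((hasDerivAt_radialFlux hm0 s).mul (hasDerivAt_radialSol hm0 s)).mul
      ((hM s).pow 2)).sub (hM s)).congr_deriv ?_
    simp only [Pi.mul_apply, Pi.pow_apply]
    norm_num
    ring
  have hMc : Continuous M := continuous_iff_continuousAt.2 fun s => (hM s).continuousAt
  have hFc : Continuous (radialFlux m) :=
    continuous_iff_continuousAt.2 fun s => (hasDerivAt_radialFlux hm0 s).continuousAt
  have hf0 := continuous_radialSol hm0
  have hf2 := continuous_radialSol (m := m + 2) (by omega)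
  have hdc := (contDiff_cutoffDensity hm0 hr hrd).continuous
  have hle := intervalIntegral.integral_mono_on (μ := volume) hη.le
    (f := fun s => s ^ (m - 1) * (testProfile m r d η (s ^ 2) ^ 2 +
      (2 * s * deriv (testProfile m r d η) (s ^ 2)) ^ 2))
    (g := fun s => s ^ (m - 1) * radialSol m s * radialSol m s * M s ^ 2 +
        radialFlux m s * (s / m * radialSol (m + 2) s) * M s ^ 2 -
        radialFlux m s * radialSol m s * (2 * M s * (2 * s * cutoffDensity m r d (s ^ 2))) +
        2 * s * cutoffDensity m r d (s ^ 2))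
    (Continuous.intervalIntegrable (by fun_prop) _ _)
    (Continuous.intervalIntegrable (by fun_prop) _ _) ?_
  · rw [intervalIntegral.integral_eq_sub_of_hasDerivAt (fun s _ => hT s)
      (Continuous.intervalIntegrable (by fun_prop) _ _)] at hle
    refine hle.trans_eq ?_
    have hMη : M η = 1 / (radialSol m η * radialFlux m η) := by simp [hMdef, cutoffQuot]
    have hM0 : M 0 = cutoffQuot m r d η (r ^ 2) := by
      rw [← cutoffQuot_zero m η hm0 hr hrd, hMdef]
      simp
    have hF0 : radialFlux m 0 = 0 := by simp [radialFlux, hm0.ne']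
    have := radialFlux_pos hm0 hη
    have := radialSol_pos hm0 η
    rw [hF0, hM0, hMη]
    field_simp
    ring
  · intro s hs
    rw [hderiv]
    rcases hs.1.eq_or_lt with rfl | hs0
    · have : (0 : ℝ) ^ (m - 1) = 0 := zero_pow (by omega)
      simp [this, radialFlux, hm0.ne']
    · have hf := radialSol_pos hm0 s
      rw [two_mul_cutoffDensity_sq hm0 r d hs0, radialFlux_eq hm0]
      set χ := Real.smoothTransition ((s ^ 2 - r ^ 2) / (d ^ 2 - r ^ 2))
      have hχ0 : 0 ≤ χ := Real.smoothTransition.nonneg _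
      have hχ1 : χ ≤ 1 := Real.smoothTransition.le_one _
      have hp : testProfile m r d η (s ^ 2) = radialSol m s * M s := rfl
      rw [hp]
      set A := s / m * radialSol (m + 2) s
      set j := 1 / (s ^ (m - 1) * radialSol m s ^ 2) with hj
      have hj0 : 0 < j := by positivity
      have hjf : s ^ (m - 1) * radialSol m s ^ 2 * j = 1 := by rw [hj]; field_simp
      have e : s ^ (m - 1) * ((radialSol m s * M s) ^ 2 +
          (A * M s - radialSol m s * (χ * j)) ^ 2) =
          s ^ (m - 1) * radialSol m s * radialSol m s * M s ^ 2 +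
          s ^ (m - 1) * A * A * M s ^ 2 -
          s ^ (m - 1) * A * radialSol m s * (2 * M s * (χ * j)) +
          χ ^ 2 * j * (s ^ (m - 1) * radialSol m s ^ 2 * j) := by ring
      rw [e, hjf]
      -- The only discrepancy is `χ² j ≤ χ j`, as `0 ≤ χ ≤ 1`.
      nlinarith [mul_nonneg (mul_nonneg hχ0 (sub_nonneg.2 hχ1)) hj0.le]

/-! ### Integration in polar coordinates -/

theorem lintegral_ball_polar (hm : 0 < m) (η : ℝ) {F : E m → ℝ≥0∞} (hF : Measurable F) :
    ∫⁻ x in B m η, F x = ∫⁻ θ : Metric.sphere (0 : E m) 1, (∫⁻ s in Ioo (0 : ℝ) η,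
      ENNReal.ofReal (s ^ (m - 1)) * F (s • (θ : E m))) ∂(volume : Measure (E m)).toSphere := by
  have : Nontrivial (E m) := by
    have : Nonempty (Fin m) := ⟨⟨0, hm⟩⟩
    infer_instance
  have hmp := (volume : Measure (E m)).measurePreserving_homeomorphUnitSphereProd
  set g : E m → ℝ≥0∞ := (B m η).indicator F with hg
  have hgm : Measurable g := hF.indicator Metric.isOpen_ball.measurableSet
  have hgs : Measurable fun p : Metric.sphere (0 : E m) 1 × Ioi (0 : ℝ) =>
      g ((p.2 : ℝ) • (p.1 : E m)) :=
    hgm.comp (by fun_prop)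
  rw [← lintegral_indicator Metric.isOpen_ball.measurableSet, ← hg]
  have h1 : ∫⁻ x, g x = ∫⁻ x in ({0}ᶜ : Set (E m)), g x := by
    rw [setLIntegral_congr (t := univ) (by simp [ae_eq_univ]), Measure.restrict_univ]
  rw [h1, ← lintegral_subtype_comap (measurableSet_singleton _).compl]
  have h2 : ∫⁻ x : ({0}ᶜ : Set (E m)), g x ∂(Measure.comap (↑) (volume : Measure (E m))) =
      ∫⁻ p, g ((p.2 : ℝ) • (p.1 : E m)) ∂((volume : Measure (E m)).toSphere.prod
        (Measure.volumeIoiPow (Module.finrank ℝ (E m) - 1))) := by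
    rw [← hmp.lintegral_comp hgs]
    refine lintegral_congr fun x => ?_
    have hx : ‖(x : E m)‖ ≠ 0 := norm_ne_zero_iff.2 x.2
    simp [smul_smul, hx]
  rw [h2, lintegral_prod _ hgs.aemeasurable]
  refine lintegral_congr fun θ => ?_
  have hgθ : Measurable fun s : ℝ => g (s • (θ : E m)) := hgm.comp (by fun_prop)
  have hgθ' : Measurable fun s : Ioi (0 : ℝ) => g ((s : ℝ) • (θ : E m)) :=
    hgθ.comp measurable_subtype_coe
  rw [Measure.volumeIoiPow, lintegral_withDensity_eq_lintegral_mul _ (by fun_prop) hgθ']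
  simp only [Pi.mul_apply]
  rw [lintegral_subtype_comap measurableSet_Ioi
    (fun s : ℝ => ENNReal.ofReal (s ^ (Module.finrank ℝ (E m) - 1)) * g (s • (θ : E m))),
    finrank_euclideanSpace_fin, ← lintegral_indicator measurableSet_Ioi,
    ← lintegral_indicator measurableSet_Ioo]
  refine lintegral_congr fun s => ?_
  by_cases hs : 0 < s
  · have hn : ‖s • (θ : E m)‖ = s := by simp [norm_smul, abs_of_pos hs]
    by_cases hsη : s < η <;> simp [hg, indicator, hs, hsη, hn]
  · simp [indicator, hs]

theorem lintegral_surfaceMeasure (r : ℝ) {F : E m → ℝ≥0∞} (hF : Measurable F) :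
    ∫⁻ x, F x ∂(surfaceMeasure m r) = ∫⁻ θ : Metric.sphere (0 : E m) 1,
      ENNReal.ofReal (r ^ (m - 1)) * F (r • (θ : E m)) ∂(volume : Measure (E m)).toSphere := by
  rw [surfaceMeasure, lintegral_smul_measure, lintegral_map hF (by fun_prop), smul_eq_mul,
    lintegral_const_mul' _ _ ENNReal.ofReal_ne_top]

/-! ### The norms as `L²` norms -/

theorem rpow_half_sq (a : ℝ≥0∞) : (a ^ (1 / 2 : ℝ)) ^ 2 = a := by
  rw [← ENNReal.rpow_natCast, ← ENNReal.rpow_mul]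
  norm_num

theorem sphereNorm_sq (r : ℝ) (g : E m → ℂ) :
    sphereNorm r g ^ 2 = ∫⁻ x, ‖g x‖ₑ ^ 2 ∂(surfaceMeasure m r) :=
  rpow_half_sq _

theorem h1Norm_sq (U : Set (E m)) (u : E m → ℂ) (G : E m → EuclideanSpace ℂ (Fin m)) :
    h1Norm U u G ^ 2 = ∫⁻ x in U, (‖u x‖ₑ ^ 2 + ‖G x‖ₑ ^ 2) :=
  rpow_half_sq _

theorem sphereNorm_eq_eLpNorm (r : ℝ) (g : E m → ℂ) :
    sphereNorm r g = eLpNorm g 2 (surfaceMeasure m r) := by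
  rw [sphereNorm, eLpNorm_eq_lintegral_rpow_enorm_toReal (by norm_num) (by norm_num)]
  simp

/-- Viewing `(u, G)` as one map into an `L²` product makes the triangle inequality for `h1Norm` an
instance of Minkowski's. -/
theorem h1Norm_eq_eLpNorm (U : Set (E m)) (u : E m → ℂ) (G : E m → EuclideanSpace ℂ (Fin m)) :
    h1Norm U u G = eLpNorm (fun x => WithLp.toLp 2 (u x, G x)) 2 (volume.restrict U) := by
  rw [h1Norm, eLpNorm_eq_lintegral_rpow_enorm_toReal (by norm_num) (by norm_num)]
  have h : ∀ x, ‖WithLp.toLp 2 (u x, G x)‖ₑ ^ (2 : ℝ) = ‖u x‖ₑ ^ 2 + ‖G x‖ₑ ^ 2 := by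
    intro x
    have h1 := WithLp.prod_norm_sq_eq_of_L2 (WithLp.toLp 2 (u x, G x))
    rw [ENNReal.rpow_ofNat, ← ofReal_norm, ← ofReal_norm, ← ofReal_norm,
      ← ENNReal.ofReal_pow (norm_nonneg _), ← ENNReal.ofReal_pow (norm_nonneg _),
      ← ENNReal.ofReal_pow (norm_nonneg _), ← ENNReal.ofReal_add (by positivity) (by positivity),
      h1, WithLp.toLp_fst, WithLp.toLp_snd]
  simp [h]

theorem aestronglyMeasurable_toLp_prod {μ : Measure (E m)} {u : E m → ℂ}
    {G : E m → EuclideanSpace ℂ (Fin m)} (hu : AEStronglyMeasurable u μ)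
    (hG : AEStronglyMeasurable G μ) :
    AEStronglyMeasurable (fun x => WithLp.toLp 2 (u x, G x)) μ :=
  (WithLp.prod_continuous_toLp 2 ℂ (EuclideanSpace ℂ (Fin m))).comp_aestronglyMeasurable
    (hu.prodMk hG)

theorem sphereNorm_le_add {r : ℝ} {f g : E m → ℂ}
    (hf : AEStronglyMeasurable f (surfaceMeasure m r))
    (hg : AEStronglyMeasurable g (surfaceMeasure m r)) :
    sphereNorm r g ≤ sphereNorm r f + sphereNorm r (fun x => f x - g x) := by
  simp only [sphereNorm_eq_eLpNorm]
  have h := eLpNorm_sub_le hf (hf.sub hg) (p := 2) (by norm_num)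
  rw [sub_sub_cancel] at h
  exact h

theorem h1Norm_le_add {U : Set (E m)} {u v : E m → ℂ} {G H : E m → EuclideanSpace ℂ (Fin m)}
    (hu : AEStronglyMeasurable u (volume.restrict U))
    (hG : AEStronglyMeasurable G (volume.restrict U))
    (hv : AEStronglyMeasurable v (volume.restrict U))
    (hH : AEStronglyMeasurable H (volume.restrict U)) :
    h1Norm U v H ≤ h1Norm U u G + h1Norm U (fun x => v x - u x) (fun x => H x - G x) := by
  simp only [h1Norm_eq_eLpNorm]
  have h := eLpNorm_add_le (aestronglyMeasurable_toLp_prod hu hG)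
    (aestronglyMeasurable_toLp_prod (hv.sub hu) (hH.sub hG)) (p := 2) (by norm_num)
  refine le_of_eq_of_le ?_ h
  congr 1
  ext1 x
  simp only [Pi.add_apply, ← WithLp.toLp_add, Pi.sub_apply, Prod.mk_add_mk, add_sub_cancel]

theorem continuous_grad {φ : E m → ℂ} (hφ : ContDiff ℝ ∞ φ) : Continuous (grad φ) := by
  have h := hφ.continuous_fderiv (by simp)
  refine (PiLp.continuous_toLp 2 _).comp (continuous_pi fun i => ?_)
  exact h.clm_apply continuous_const

theorem norm_fderiv_apply_le (φ : E m → ℂ) (x v : E m) :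
    ‖fderiv ℝ φ x v‖ ≤ ‖v‖ * ‖grad φ x‖ := by
  have hv : v = ∑ i, v i • EuclideanSpace.single i (1 : ℝ) := by
    have h := (EuclideanSpace.basisFun (Fin m) ℝ).sum_repr v
    simpa using h.symm
  have h1 : ‖fderiv ℝ φ x v‖ ≤ ∑ i, ‖v i‖ * ‖grad φ x i‖ := by
    conv_lhs => rw [hv, map_sum]
    refine (norm_sum_le _ _).trans_eq (Finset.sum_congr rfl fun i _ => ?_)
    rw [map_smul, norm_smul]
    rfl
  refine h1.trans ?_
  rw [EuclideanSpace.norm_eq, EuclideanSpace.norm_eq]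
  exact Real.sum_mul_le_sqrt_mul_sqrt _ _ _

/-! ### The sharp trace inequality -/

theorem sphereNorm_sq_le_of_contDiff (hm : 2 ≤ m) {r η : ℝ} (hr : 0 < r) (hrη : r < η)
    {φ : E m → ℂ} (hφ : ContDiff ℝ ∞ φ) :
    sphereNorm r φ ^ 2 ≤
      ENNReal.ofReal (traceConstSq m η r) * h1Norm (B m η) φ (grad φ) ^ 2 := by
  have hm0 : 0 < m := by omega
  have hφc := hφ.continuous
  have hgc := continuous_grad hφ
  rw [sphereNorm_sq, h1Norm_sq, lintegral_surfaceMeasure r (by fun_prop),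
    lintegral_ball_polar hm0 η (by fun_prop), ← lintegral_const_mul' _ _ ENNReal.ofReal_ne_top]
  refine lintegral_mono fun θ => ?_
  have hθ : ‖(θ : E m)‖ = 1 := by simp
  have hv : ∀ s : ℝ, HasDerivAt (fun s : ℝ => φ (s • (θ : E m)))
      (fderiv ℝ φ (s • (θ : E m)) θ) s := by
    intro s
    have h1 : HasDerivAt (fun s : ℝ => s • (θ : E m)) (θ : E m) s := by
      simpa using (hasDerivAt_id s).smul_const (θ : E m)
    exact ((hφ.differentiable (by simp)) _).hasFDerivAt.comp_hasDerivAt s h1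
  have hv' : Continuous fun s : ℝ => fderiv ℝ φ (s • (θ : E m)) θ := by
    have h := hφ.continuous_fderiv (by simp)
    exact (h.comp (by fun_prop)).clm_apply continuous_const
  have hray := ray_trace_inequality hm hr hrη hv hv'
  have hη := hr.trans hrη
  have hA := (traceConstSq_pos hm0 hr hrη.le).le
  have hI : ENNReal.ofReal (∫ s in (0 : ℝ)..η, s ^ (m - 1) * (‖φ (s • (θ : E m))‖ ^ 2 +
      ‖fderiv ℝ φ (s • (θ : E m)) θ‖ ^ 2)) =
      ∫⁻ s in Ioo (0 : ℝ) η, ENNReal.ofReal (s ^ (m - 1) * (‖φ (s • (θ : E m))‖ ^ 2 +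
      ‖fderiv ℝ φ (s • (θ : E m)) θ‖ ^ 2)) := by
    have hc : Continuous fun s : ℝ => s ^ (m - 1) * (‖φ (s • (θ : E m))‖ ^ 2 +
      ‖fderiv ℝ φ (s • (θ : E m)) θ‖ ^ 2) := by fun_prop
    rw [intervalIntegral.integral_of_le hη.le, integral_Ioc_eq_integral_Ioo,
      ofReal_integral_eq_lintegral_ofReal]
    · exact (hc.integrableOn_Icc (a := 0) (b := η) (μ := volume)).mono_set Ioo_subset_Icc_self
    · filter_upwards [ae_restrict_mem measurableSet_Ioo] with s hs
      have := hs.1.le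
      simp only [Pi.zero_apply]
      positivity
  calc ENNReal.ofReal (r ^ (m - 1)) * ‖φ (r • (θ : E m))‖ₑ ^ 2
      = ENNReal.ofReal (r ^ (m - 1) * ‖φ (r • (θ : E m))‖ ^ 2) := by
        rw [← ofReal_norm, ← ENNReal.ofReal_pow (norm_nonneg _),
          ← ENNReal.ofReal_mul (by positivity)]
    _ ≤ _ := ENNReal.ofReal_le_ofReal hray
    _ = _ := by rw [ENNReal.ofReal_mul hA, hI]
    _ ≤ _ := by
        refine mul_le_mul' le_rfl (setLIntegral_mono' measurableSet_Ioo fun s hs => ?_)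
        rw [ENNReal.ofReal_mul (pow_nonneg hs.1.le _)]
        gcongr
        rw [ENNReal.ofReal_add (by positivity) (by positivity),
          ENNReal.ofReal_pow (norm_nonneg _), ENNReal.ofReal_pow (norm_nonneg _), ofReal_norm]
        gcongr
        rw [← ofReal_norm]
        refine ENNReal.ofReal_le_ofReal ((norm_fderiv_apply_le φ _ _).trans_eq ?_)
        rw [hθ, one_mul]

theorem sphereNorm_le_of_contDiff (hm : 2 ≤ m) {r η : ℝ} (hr : 0 < r) (hrη : r < η)
    {φ : E m → ℂ} (hφ : ContDiff ℝ ∞ φ) :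
    sphereNorm r φ ≤
      ENNReal.ofReal (Real.sqrt (traceConstSq m η r)) * h1Norm (B m η) φ (grad φ) := by
  have h := sphereNorm_sq_le_of_contDiff hm hr hrη hφ
  have hA := (traceConstSq_pos (m := m) (by omega) hr hrη.le).le
  refine (ENNReal.pow_le_pow_left_iff two_ne_zero).1 ?_
  rw [mul_pow, ← ENNReal.ofReal_pow (Real.sqrt_nonneg _), Real.sq_sqrt hA]
  exact h

/-- Both sides pass to the limit along the smooth approximants in the definition of the trace. -/
theorem sphereNorm_le_of_isTrace (hm : 2 ≤ m) {r η : ℝ} (hr : 0 < r) (hrη : r < η)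
    {u g : E m → ℂ} {G : E m → EuclideanSpace ℂ (Fin m)} (hu : IsH1 (B m η) u G)
    (hg : IsTrace r η u G g) :
    sphereNorm r g ≤ ENNReal.ofReal (Real.sqrt (traceConstSq m η r)) * h1Norm (B m η) u G := by
  obtain ⟨hgL, φ, hφ, hφu, hφg⟩ := hg
  set K := ENNReal.ofReal (Real.sqrt (traceConstSq m η r))
  have hlim := (ENNReal.Tendsto.const_mul (a := K)
    (tendsto_const_nhds (x := h1Norm (B m η) u G) |>.add hφu)
    (Or.inr ENNReal.ofReal_ne_top)).add hφg
  rw [add_zero, add_zero] at hlim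
  refine ge_of_tendsto' hlim fun n => ?_
  have hφc := (hφ n).continuous
  have hgc := continuous_grad (hφ n)
  refine (sphereNorm_le_add hφc.aestronglyMeasurable hgL.1).trans ?_
  gcongr
  refine (sphereNorm_le_of_contDiff hm hr hrη (hφ n)).trans ?_
  gcongr
  exact h1Norm_le_add hu.memLp.1 hu.memLp_grad.1 hφc.aestronglyMeasurable
    hgc.aestronglyMeasurable

theorem optTraceConst_le (hm : 2 ≤ m) {r η : ℝ} (hr : 0 < r) (hrη : r < η) :
    optTraceConst m r η ≤ ENNReal.ofReal (Real.sqrt (traceConstSq m η r)) := by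
  refine sSup_le ?_
  rintro q ⟨u, G, g, hu, -, hg, rfl⟩
  exact ENNReal.div_le_of_le_mul (sphereNorm_le_of_isTrace hm hr hrη hu hg)

/-! ### Almost optimal radial functions -/

theorem memLp_ball_of_continuous {F : Type*} [NormedAddCommGroup F] [SecondCountableTopology F]
    [MeasurableSpace F] [BorelSpace F] {f : E m → F} (hf : Continuous f) (η : ℝ) :
    MemLp f 2 (volume.restrict (B m η)) := by
  obtain ⟨C, hC⟩ := (isCompact_closedBall (0 : E m) η).exists_bound_of_continuousOn
    hf.continuousOn
  have : IsFiniteMeasure (volume.restrict (B m η)) :=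
    ⟨by rw [Measure.restrict_apply_univ]; exact measure_ball_lt_top⟩
  refine MemLp.of_bound hf.aestronglyMeasurable C ?_
  filter_upwards [ae_restrict_mem Metric.isOpen_ball.measurableSet] with x hx
  exact hC x (Metric.ball_subset_closedBall hx)

theorem isWeakGradient_grad (U : Set (E m)) {u : E m → ℂ} (hu : ContDiff ℝ ∞ u) :
    IsWeakGradient U u (grad u) := by
  intro φ hφ hφc hφU i
  set v : E m := EuclideanSpace.single i 1
  have hφd : ∀ x, HasFDerivAt (fun x => ((φ x : ℝ) : ℂ))
      (Complex.ofRealCLM.comp (fderiv ℝ φ x)) x := fun x =>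
    Complex.ofRealCLM.hasFDerivAt.comp x ((hφ.differentiable (by simp)) x).hasFDerivAt
  have hfd : ∀ x, fderiv ℝ (fun x => ((φ x : ℝ) : ℂ)) x v = ((fderiv ℝ φ x v : ℝ) : ℂ) := by
    intro x
    rw [(hφd x).fderiv]
    rfl
  have hφcont : Continuous fun x => ((φ x : ℝ) : ℂ) := Complex.continuous_ofReal.comp hφ.continuous
  have hφ'cont : Continuous fun x => ((fderiv ℝ φ x v : ℝ) : ℂ) :=
    Complex.continuous_ofReal.comp
      ((hφ.continuous_fderiv (by simp)).clm_apply continuous_const)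
  have hcs : HasCompactSupport fun x => ((φ x : ℝ) : ℂ) := hφc.comp_left Complex.ofReal_zero
  have hcs' : HasCompactSupport fun x => ((fderiv ℝ φ x v : ℝ) : ℂ) :=
    (hφc.fderiv_apply ℝ v).comp_left Complex.ofReal_zero
  have hu' : Continuous fun x => fderiv ℝ u x v :=
    (hu.continuous_fderiv (by simp)).clm_apply continuous_const
  have h := integral_mul_fderiv_eq_neg_fderiv_mul_of_integrable (μ := (volume : Measure (E m)))
    (f := u) (g := fun x => ((φ x : ℝ) : ℂ)) (v := v)
    ((hu'.mul hφcont).integrable_of_hasCompactSupport hcs.mul_left)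
    (by simp only [hfd]
        exact (hu.continuous.mul hφ'cont).integrable_of_hasCompactSupport hcs'.mul_left)
    ((hu.continuous.mul hφcont).integrable_of_hasCompactSupport hcs.mul_left)
    (fun x _ => (hu.differentiable (by simp)) x) (fun x _ => (hφd x).differentiableAt)
  simp only [hfd] at h
  rw [setIntegral_eq_integral_of_forall_compl_eq_zero, setIntegral_eq_integral_of_forall_compl_eq_zero]
  · exact h
  · intro x hx
    rw [image_eq_zero_of_notMem_tsupport fun hx' => hx (hφU hx')]
    simp
  · intro x hx
    have : fderiv ℝ φ x = 0 := image_eq_zero_of_notMem_tsupport fun hx' =>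
      hx (hφU (tsupport_fderiv_subset ℝ hx'))
    simp [this]

theorem isH1_of_contDiff (η : ℝ) {u : E m → ℂ} (hu : ContDiff ℝ ∞ u) :
    IsH1 (B m η) u (grad u) where
  memLp := memLp_ball_of_continuous hu.continuous η
  memLp_grad := memLp_ball_of_continuous (continuous_grad hu) η
  weakGradient := isWeakGradient_grad _ hu

instance (m : ℕ) (r : ℝ) : IsFiniteMeasure (surfaceMeasure m r) := by
  refine ⟨?_⟩
  rw [surfaceMeasure, Measure.smul_apply, smul_eq_mul]
  exact ENNReal.mul_lt_top ENNReal.ofReal_lt_top (measure_lt_top _ _)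

theorem isTrace_of_contDiff (r η : ℝ) {u : E m → ℂ} (hu : ContDiff ℝ ∞ u) :
    IsTrace r η u (grad u) u := by
  refine ⟨?_, fun _ => u, fun _ => hu, ?_, ?_⟩
  · obtain ⟨C, hC⟩ := (isCompact_sphere (0 : E m) |r|).exists_bound_of_continuousOn
      hu.continuous.continuousOn
    refine MemLp.of_bound hu.continuous.aestronglyMeasurable C ?_
    refine Measure.ae_smul_measure ?_ _
    have hmeas : MeasurableSet {x : E m | ‖u x‖ ≤ C} :=
      (isClosed_le hu.continuous.norm continuous_const).measurableSet
    rw [ae_map_iff (by fun_prop) hmeas]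
    refine Eventually.of_forall fun θ => hC _ ?_
    simp [norm_smul]
  · simp [h1Norm]
  · simp [sphereNorm]

theorem norm_grad_radial {P : ℝ → ℝ} (hP : ContDiff ℝ ∞ P) (x : E m) :
    ‖grad (fun x : E m => ((P (‖x‖ ^ 2) : ℝ) : ℂ)) x‖ = |2 * ‖x‖ * deriv P (‖x‖ ^ 2)| := by
  have h1 : HasFDerivAt (fun x : E m => ‖x‖ ^ 2) (2 • innerSL ℝ x) x :=
    (hasStrictFDerivAt_norm_sq x).hasFDerivAt
  have h2 := ((hP.differentiable (by simp)) (‖x‖ ^ 2)).hasDerivAt.comp_hasFDerivAt x h1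
  have h3 : HasFDerivAt (fun x : E m => ((P (‖x‖ ^ 2) : ℝ) : ℂ)) _ x :=
    Complex.ofRealCLM.hasFDerivAt.comp x h2
  have h4 : ∀ i, grad (fun x : E m => ((P (‖x‖ ^ 2) : ℝ) : ℂ)) x i =
      ((2 * deriv P (‖x‖ ^ 2) * x i : ℝ) : ℂ) := by
    intro i
    rw [grad]
    simp only [h3.fderiv]
    simp [EuclideanSpace.inner_single_right]
    ring
  rw [EuclideanSpace.norm_eq]
  simp only [h4, Complex.norm_real, Real.norm_eq_abs, sq_abs]
  rw [← Real.sqrt_sq_eq_abs]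
  congr 1
  rw [mul_pow, mul_pow 2 ‖x‖, EuclideanSpace.norm_sq_eq, ← EuclideanSpace.norm_sq_eq]
  simp only [mul_pow]
  rw [← Finset.mul_sum]
  simp only [EuclideanSpace.norm_sq_eq, Real.norm_eq_abs, sq_abs]
  ring

theorem h1Norm_radial_sq (hm : 0 < m) {η : ℝ} (hη : 0 ≤ η) {P : ℝ → ℝ} (hP : ContDiff ℝ ∞ P) :
    h1Norm (B m η) (fun x : E m => ((P (‖x‖ ^ 2) : ℝ) : ℂ))
        (grad fun x : E m => ((P (‖x‖ ^ 2) : ℝ) : ℂ)) ^ 2 =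
      ENNReal.ofReal (∫ s in (0 : ℝ)..η, s ^ (m - 1) * (P (s ^ 2) ^ 2 +
        (2 * s * deriv P (s ^ 2)) ^ 2)) * (volume : Measure (E m)).toSphere univ := by
  have hPc := hP.continuous
  have hPd := hP.continuous_deriv (by simp)
  have hint : ∀ x : E m, ‖((P (‖x‖ ^ 2) : ℝ) : ℂ)‖ₑ ^ 2 +
      ‖grad (fun x : E m => ((P (‖x‖ ^ 2) : ℝ) : ℂ)) x‖ₑ ^ 2 =
      ENNReal.ofReal (P (‖x‖ ^ 2) ^ 2 + (2 * ‖x‖ * deriv P (‖x‖ ^ 2)) ^ 2) := by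
    intro x
    rw [← ofReal_norm, ← ofReal_norm, norm_grad_radial hP, Complex.norm_real, Real.norm_eq_abs,
      ← ENNReal.ofReal_pow (abs_nonneg _), ← ENNReal.ofReal_pow (abs_nonneg _), sq_abs, sq_abs,
      ENNReal.ofReal_add (sq_nonneg _) (sq_nonneg _)]
  rw [h1Norm_sq]
  simp only [hint]
  rw [lintegral_ball_polar hm η (by fun_prop), ← lintegral_const]
  refine lintegral_congr fun θ => ?_
  have hc : Continuous fun s : ℝ => s ^ (m - 1) * (P (s ^ 2) ^ 2 +
      (2 * s * deriv P (s ^ 2)) ^ 2) := by fun_prop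
  rw [intervalIntegral.integral_of_le hη, integral_Ioc_eq_integral_Ioo,
    ofReal_integral_eq_lintegral_ofReal]
  · refine setLIntegral_congr_fun measurableSet_Ioo fun s hs => ?_
    have hn : ‖s • (θ : E m)‖ = s := by simp [norm_smul, abs_of_pos hs.1]
    simp only [hn]
    rw [ENNReal.ofReal_mul (pow_nonneg hs.1.le _)]
  · exact (hc.integrableOn_Icc (a := 0) (b := η) (μ := volume)).mono_set Ioo_subset_Icc_self
  · filter_upwards [ae_restrict_mem measurableSet_Ioo] with s hs
    have := hs.1.le
    simp only [Pi.zero_apply]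
    positivity

theorem sphereNorm_radial_sq {r : ℝ} (hr : 0 < r) {P : ℝ → ℝ} (hP : Continuous P) :
    sphereNorm r (fun x : E m => ((P (‖x‖ ^ 2) : ℝ) : ℂ)) ^ 2 =
      ENNReal.ofReal (r ^ (m - 1) * P (r ^ 2) ^ 2) * (volume : Measure (E m)).toSphere univ := by
  rw [sphereNorm_sq, lintegral_surfaceMeasure r (by fun_prop), ← lintegral_const]
  refine lintegral_congr fun θ => ?_
  have hn : ‖r • (θ : E m)‖ = r := by simp [norm_smul, abs_of_pos hr]
  rw [hn, ← ofReal_norm, Complex.norm_real, Real.norm_eq_abs,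
    ← ENNReal.ofReal_pow (abs_nonneg _), sq_abs, ENNReal.ofReal_mul (by positivity)]

theorem le_optTraceConst_of_lt (hm : 2 ≤ m) {r d η : ℝ} (hr : 0 < r) (hrd : r < d) (hdη : d ≤ η) :
    ENNReal.ofReal (Real.sqrt (r ^ (m - 1) * radialSol m r ^ 2 * radialQuot m η d)) ≤
      optTraceConst m r η := by
  have hm0 : 0 < m := by omega
  have hrη := hrd.trans_le hdη
  have hη := hr.trans hrη
  have hN := radialQuot_pos hm0 (hr.trans hrd) hdη
  have hf := radialSol_pos hm0 r
  have hP := contDiff_testProfile hm0 η hr hrd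
  have hE := energy_testProfile_le hm hr hrd hdη
  have hNK := radialQuot_le_cutoffQuot hm0 hr hrd hdη
  set K := cutoffQuot m r d η (r ^ 2) with hK
  set P := testProfile m r d η
  have hPr : P (r ^ 2) = radialSol m r * K := rfl
  set u : E m → ℂ := fun x => ((P (‖x‖ ^ 2) : ℝ) : ℂ) with hu_def
  have hu : ContDiff ℝ ∞ u :=
    Complex.ofRealCLM.contDiff.comp (hP.comp (contDiff_norm_sq ℝ))
  have hs := sphereNorm_radial_sq (m := m) hr hP.continuous
  have hh := h1Norm_radial_sq hm0 hη.le hP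
  rw [← hu_def] at hs hh
  have : Nontrivial (E m) := by
    have : Nonempty (Fin m) := ⟨⟨0, hm0⟩⟩
    infer_instance
  have hS : (volume : Measure (E m)).toSphere univ ≠ 0 := by
    rw [Ne, Measure.measure_univ_eq_zero]
    exact Measure.toSphere_ne_zero _
  have hK0 : 0 < K := hN.trans_le hNK
  have hs0 : sphereNorm r u ^ 2 ≠ 0 := by
    rw [hs, hPr]
    refine mul_ne_zero ?_ hS
    rw [Ne, ENNReal.ofReal_eq_zero, not_le]
    positivity
  -- The trace inequality itself excludes a vanishing norm, since `u` is nonzero on the sphere.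
  have hh0 : h1Norm (B m η) u (grad u) ≠ 0 := by
    intro h0
    have h := sphereNorm_sq_le_of_contDiff hm hr hrη hu
    rw [h0] at h
    simp only [ne_eq, OfNat.ofNat_ne_zero, not_false_eq_true, zero_pow, mul_zero,
      nonpos_iff_eq_zero] at h
    exact hs0 (by rw [h])
  have hhtop : h1Norm (B m η) u (grad u) ≠ ⊤ := by
    intro h0
    rw [h0] at hh
    exact ENNReal.mul_ne_top ENNReal.ofReal_ne_top
      (measure_ne_top (volume : Measure (E m)).toSphere univ) (hh.symm.trans (by simp))
  refine le_sSup_of_le ⟨u, grad u, u, isH1_of_contDiff η hu, hh0, isTrace_of_contDiff r η hu, rfl⟩ ?_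
  rw [ENNReal.le_div_iff_mul_le (Or.inl hh0) (Or.inl hhtop)]
  refine (ENNReal.pow_le_pow_left_iff two_ne_zero).1 ?_
  rw [mul_pow, hs, hh, ← ENNReal.ofReal_pow (Real.sqrt_nonneg _), Real.sq_sqrt (by positivity),
    ← mul_assoc, ← ENNReal.ofReal_mul (by positivity), hPr]
  refine mul_le_mul' (ENNReal.ofReal_le_ofReal ?_) le_rfl
  have hA : 0 ≤ r ^ (m - 1) * radialSol m r ^ 2 * radialQuot m η d := by positivity
  -- The energy is at most `K` and the value at radius `r` is `f(r) K`, so the squared quotient is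
  -- at least `r^(m-1) f(r)² K`, with `K ≥ N(d)`.
  calc _ ≤ r ^ (m - 1) * radialSol m r ^ 2 * radialQuot m η d * K :=
        mul_le_mul_of_nonneg_left hE hA
    _ ≤ r ^ (m - 1) * radialSol m r ^ 2 * K * K := by gcongr
    _ = _ := by ring

theorem optTraceConst_eq (hm : 2 ≤ m) {r η : ℝ} (hr : 0 < r) (hrη : r < η) :
    optTraceConst m r η = ENNReal.ofReal (Real.sqrt (traceConstSq m η r)) := by
  refine le_antisymm (optTraceConst_le hm hr hrη) ?_
  have hc : ContinuousAt (fun d => ENNReal.ofReal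
      (Real.sqrt (r ^ (m - 1) * radialSol m r ^ 2 * radialQuot m η d))) r := by
    have := (hasDerivAt_radialQuot (m := m) (by omega) (hr.trans hrη) hr).continuousAt
    refine ENNReal.continuous_ofReal.continuousAt.comp ?_
    exact Real.continuous_sqrt.continuousAt.comp (continuousAt_const.mul this)
  refine le_of_tendsto (hc.tendsto.mono_left (nhdsWithin_le_nhds (s := Ioi r))) ?_
  filter_upwards [Ioc_mem_nhdsGT hrη] with d hd
  exact le_optTraceConst_of_lt hm hr hd.1 hd.2

/-! ### Monotonicity in the inner radius -/

/-- The quantity is `g' + (m-1)g/s` for `g = f N`. The radial equation makes its derivative `g (1 -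
(m-1)/s²)`, which is nonpositive for `s ≤ 1` and `m ≥ 2`; at `η`, where `g' = 0`, the value is
positive. -/
theorem radialFlux_mul_radialQuot_sub_nonneg (hm : 2 ≤ m) {η s : ℝ} (hs : 0 < s) (hsη : s ≤ η)
    (hη1 : η ≤ 1) :
    0 ≤ (radialFlux m s * radialQuot m η s - 1 / radialSol m s) / s ^ (m - 1) +
      (m - 1) * (radialSol m s * radialQuot m η s) / s := by
  have hm0 : 0 < m := by omega
  have hm1 : (2 : ℝ) ≤ m := by exact_mod_cast hm
  have hη := hs.trans_le hsη
  have hd : ∀ t ∈ Icc s η, HasDerivAt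
      (fun t => (radialFlux m t * radialQuot m η t - 1 / radialSol m t) / t ^ (m - 1) +
        (m - 1) * (radialSol m t * radialQuot m η t) / t)
      (radialSol m t * radialQuot m η t * (1 - (m - 1) / t ^ 2)) t := by
    intro t ht
    have ht0 := hs.trans_le ht.1
    have hf := (radialSol_pos hm0 t).ne'
    have hN := hasDerivAt_radialQuot hm0 hη ht0
    have hf' := hasDerivAt_radialSol hm0 t
    refine ((((hasDerivAt_radialFlux hm0 t).mul hN).sub
      ((hasDerivAt_const t (1 : ℝ)).div hf' hf)).div (hasDerivAt_pow (m - 1) t)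
        (by positivity)).add ((((hf'.mul hN).const_mul ((m : ℝ) - 1)).div
          (hasDerivAt_id t) ht0.ne')) |>.congr_deriv ?_
    simp only [Pi.mul_apply, Pi.sub_apply, Pi.div_apply, id]
    rw [radialFlux_eq hm0]
    obtain ⟨k, rfl⟩ : ∃ k, m = k + 2 := ⟨m - 2, by omega⟩
    have e1 : k + 2 - 1 = k + 1 := by omega
    rw [e1, Nat.add_sub_cancel]
    push_cast
    have : (k : ℝ) + 2 ≠ 0 := by positivity
    field_simp
    ring
  have hanti : AntitoneOn
      (fun t => (radialFlux m t * radialQuot m η t - 1 / radialSol m t) / t ^ (m - 1) +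
        (m - 1) * (radialSol m t * radialQuot m η t) / t) (Icc s η) := by
    refine antitoneOn_of_hasDerivWithinAt_nonpos (convex_Icc _ _)
      (fun t ht => (hd t ht).continuousAt.continuousWithinAt)
      (fun t ht => (hd t (interior_subset ht)).hasDerivWithinAt) fun t ht => ?_
    have ht' := interior_subset ht
    have ht0 := hs.trans_le ht'.1
    have hf := radialSol_pos hm0 t
    have hN := radialQuot_pos hm0 ht0 ht'.2
    refine mul_nonpos_of_nonneg_of_nonpos (by positivity) ?_
    rw [sub_nonpos, one_le_div (by positivity)]
    nlinarith [ht'.2]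
  refine le_trans ?_ (hanti ⟨le_rfl, hsη⟩ ⟨hsη, le_rfl⟩ hsη)
  have hf := radialSol_pos hm0 η
  have hF := radialFlux_pos hm0 hη
  have h0 : radialFlux m η * radialQuot m η η - 1 / radialSol m η = 0 := by
    rw [radialQuot_self]
    field_simp
    ring
  have hN := radialQuot_pos (m := m) hm0 hη le_rfl
  have : (0 : ℝ) ≤ m - 1 := by linarith
  simp only [h0, zero_div, zero_add]
  positivity

theorem monotoneOn_traceConstSq (hm : 2 ≤ m) {η : ℝ} (hη1 : η ≤ 1) :
    MonotoneOn (traceConstSq m η) (Ioo 0 η) := by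
  have hm0 : 0 < m := by omega
  have hd : ∀ s ∈ Ioo 0 η, HasDerivAt (traceConstSq m η)
      (s / m * radialSol (m + 2) s * (s ^ (m - 1) * radialSol m s * radialQuot m η s) +
        s ^ (m - 1) * radialSol m s *
          ((radialFlux m s * radialQuot m η s - 1 / radialSol m s) / s ^ (m - 1) +
            (m - 1) * (radialSol m s * radialQuot m η s) / s)) s := by
    intro s hs
    have hf := (radialSol_pos hm0 s).ne'
    have hs0 := hs.1
    have hm' : (0 : ℝ) < m := by exact_mod_cast hm0
    refine (((hasDerivAt_pow (m - 1) s).mul ((hasDerivAt_radialSol hm0 s).pow 2)).mul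
      (hasDerivAt_radialQuot hm0 (hs.1.trans hs.2) hs.1)).congr_deriv ?_
    simp only [Pi.mul_apply, Pi.pow_apply]
    rw [radialFlux_eq hm0]
    obtain ⟨k, rfl⟩ : ∃ k, m = k + 2 := ⟨m - 2, by omega⟩
    have e1 : k + 2 - 1 = k + 1 := by omega
    rw [e1, Nat.add_sub_cancel]
    push_cast
    have : (k : ℝ) + 2 ≠ 0 := by positivity
    field_simp
    ring
  refine monotoneOn_of_hasDerivWithinAt_nonneg (convex_Ioo _ _)
    (fun s hs => (hd s hs).continuousAt.continuousWithinAt)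
    (fun s hs => (hd s (interior_subset hs)).hasDerivWithinAt) fun s hs => ?_
  have hs' := interior_subset hs
  have hs0 := hs'.1
  have h := radialFlux_mul_radialQuot_sub_nonneg hm hs0 hs'.2.le hη1
  have hf := radialSol_pos hm0 s
  have hf2 := radialSol_pos (m := m + 2) (by omega) s
  have hN := radialQuot_pos hm0 hs0 hs'.2.le
  exact add_nonneg (by positivity) (mul_nonneg (by positivity) h)

/-! ### Asymptotics -/

/-- Rests on `(1 - 4x)(1 + 2x)² = 1 - 12x² - 16x³ ≤ 1`; used with `x = s²` and the bound `f ≤ 1 +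
2s²`. -/
theorem one_sub_le_one_div {x y : ℝ} (hx : 0 ≤ x) (hy : 0 < y) (hyx : y ≤ (1 + 2 * x) ^ 2) :
    1 - 4 * x ≤ 1 / y := by
  rw [le_div_iff₀ hy]
  rcases le_or_gt (1 - 4 * x) 0 with h | h
  · nlinarith
  · have := mul_le_mul_of_nonneg_left hyx h.le
    have h3 : 0 ≤ x ^ 3 := by positivity
    nlinarith [sq_nonneg x]

theorem radialQuot_le (hm : 0 < m) {η r : ℝ} (hr : 0 < r) (hrη : r ≤ η) :
    radialQuot m η r ≤ m / η ^ m + ∫ t in r..η, 1 / t ^ (m - 1) := by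
  have hη := hr.trans_le hrη
  have hm' : (0 : ℝ) < m := by exact_mod_cast hm
  have h1 := one_le_radialSol hm η
  have h2 := one_le_radialSol (m := m + 2) (by omega) η
  refine add_le_add ?_ (intervalIntegral.integral_mono_on hrη
    (intervalIntegrable_quotIntegrand hm hr hη) ?_ fun t ht => ?_)
  · rw [radialFlux, div_le_div_iff₀ (by positivity) (by positivity)]
    have : 1 ≤ radialSol m η * radialSol (m + 2) η := one_le_mul_of_one_le_of_one_le h1 h2
    calc 1 * η ^ m ≤ (radialSol m η * radialSol (m + 2) η) * η ^ m := by gcongr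
      _ = _ := by field_simp
  · refine ContinuousOn.intervalIntegrable (continuousOn_const.div (by fun_prop) fun t ht => ?_)
    rw [uIcc_of_le hrη] at ht
    have := hr.trans_le ht.1
    positivity
  · have ht0 := hr.trans_le ht.1
    have h := one_le_radialSol hm t
    gcongr
    exact le_mul_of_one_le_right (by positivity) (one_le_pow₀ h)

theorem le_radialQuot (hm : 0 < m) {η r K : ℝ} (hr : 0 < r) (hrη : r ≤ η) (hη1 : η ≤ 1)
    (hK : ∀ t ∈ Icc r η, 4 * t ^ 2 / t ^ (m - 1) ≤ K) :
    m / η ^ m * (1 - 4 * η ^ 2) + (∫ t in r..η, 1 / t ^ (m - 1)) - K * (η - r) ≤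
      radialQuot m η r := by
  have hη := hr.trans_le hrη
  have hm' : (0 : ℝ) < m := by exact_mod_cast hm
  have h1 := radialSol_le hm hη.le hη1
  have h2 := radialSol_le (m := m + 2) (by omega) hη.le hη1
  have p1 := radialSol_pos hm η
  have p2 := radialSol_pos (m := m + 2) (by omega) η
  have hint : IntervalIntegrable (fun t : ℝ => 1 / t ^ (m - 1)) volume r η := by
    refine ContinuousOn.intervalIntegrable (continuousOn_const.div (by fun_prop) fun t ht => ?_)
    rw [uIcc_of_le hrη] at ht
    have := hr.trans_le ht.1
    positivity
  have hc : m / η ^ m * (1 - 4 * η ^ 2) ≤ 1 / (radialSol m η * radialFlux m η) := by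
    have h := one_sub_le_one_div (sq_nonneg η) (mul_pos p1 p2)
      (by rw [sq (1 + 2 * η ^ 2)]; gcongr)
    calc m / η ^ m * (1 - 4 * η ^ 2)
        ≤ m / η ^ m * (1 / (radialSol m η * radialSol (m + 2) η)) := by gcongr
      _ = _ := by rw [radialFlux]; field_simp
  have hJ : (∫ t in r..η, 1 / t ^ (m - 1)) - K * (η - r) ≤
      ∫ t in r..η, 1 / (t ^ (m - 1) * radialSol m t ^ 2) := by
    have e : (∫ t in r..η, 1 / t ^ (m - 1)) - K * (η - r) = ∫ t in r..η, (1 / t ^ (m - 1) - K) := by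
      rw [intervalIntegral.integral_sub hint (by simp), intervalIntegral.integral_const, smul_eq_mul]
      ring
    rw [e]
    refine intervalIntegral.integral_mono_on hrη (hint.sub (by simp))
      (intervalIntegrable_quotIntegrand hm hr hη) fun t ht => ?_
    have ht0 := hr.trans_le ht.1
    have hf := radialSol_pos hm t
    have h := one_sub_le_one_div (sq_nonneg t) (pow_pos hf 2)
      (pow_le_pow_left₀ hf.le (radialSol_le hm ht0.le (ht.2.trans hη1)) 2)
    have h' := mul_le_mul_of_nonneg_left h (by positivity : 0 ≤ 1 / t ^ (m - 1))
    have e1 : 1 / t ^ (m - 1) * (1 - 4 * t ^ 2) = 1 / t ^ (m - 1) - 4 * t ^ 2 / t ^ (m - 1) := by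
      ring
    have e2 : 1 / t ^ (m - 1) * (1 / radialSol m t ^ 2) = 1 / (t ^ (m - 1) * radialSol m t ^ 2) := by
      field_simp
    rw [e1, e2] at h'
    linarith [hK t ht]
  rw [radialQuot]
  linarith

theorem integral_one_div_pow {n : ℕ} (hn : 0 < n) {r η : ℝ} (hr : 0 < r) (hrη : r ≤ η) :
    ∫ t in r..η, 1 / t ^ (n + 1) = (1 / r ^ n - 1 / η ^ n) / n := by
  have hn' : (0 : ℝ) < n := by exact_mod_cast hn
  have hpos : ∀ t ∈ uIcc r η, 0 < t := fun t ht => by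
    rw [uIcc_of_le hrη] at ht
    exact hr.trans_le ht.1
  rw [intervalIntegral.integral_eq_sub_of_hasDerivAt (f := fun t => -(1 / t ^ n) / n)]
  · ring
  · intro t ht
    have ht0 := hpos t ht
    refine (((hasDerivAt_const t (1 : ℝ)).div (hasDerivAt_pow n t)
      (by positivity)).neg.div_const _).congr_deriv ?_
    obtain ⟨k, rfl⟩ : ∃ k, n = k + 1 := ⟨n - 1, by omega⟩
    rw [Nat.add_sub_cancel]
    field_simp
    ring
  · refine ContinuousOn.intervalIntegrable (continuousOn_const.div (by fun_prop) fun t ht => ?_)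
    have := hpos t ht
    positivity

theorem radialSol_sq_le (hm : 0 < m) {r : ℝ} (hr : 0 ≤ r) (hr1 : r ≤ 1) :
    radialSol m r ^ 2 ≤ 1 + 8 * r ^ 2 := by
  have h := pow_le_pow_left₀ (radialSol_pos hm r).le (radialSol_le hm hr hr1) 2
  have : r ^ 2 ≤ 1 := by nlinarith
  nlinarith [sq_nonneg r]

theorem abs_traceConstSq_sub_le_of_three_le {n : ℕ} (hn : 0 < n) {r η : ℝ} (hr : 0 < r)
    (hrη : r < η) (hη1 : η ≤ 1) :
    |traceConstSq (n + 2) η r - (n + 2) * r ^ (n + 1) / η ^ (n + 2) - r / n| ≤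
      8 * (n + 3) * (r ^ (n + 1) / η ^ (n + 2) * η ^ 2 + r ^ 2) := by
  have hη := hr.trans hrη
  have hn' : (1 : ℝ) ≤ n := by exact_mod_cast hn
  have hup := radialQuot_le (m := n + 2) (by omega) hr hrη.le
  -- For `m ≥ 3` the ratio `4t²/t^(m-1)` is nonincreasing, so its value at `r` serves as `K`.
  have hlo := le_radialQuot (m := n + 2) (K := 4 * r ^ 2 / r ^ (n + 1)) (by omega) hr hrη.le hη1 ?_
  · have e1 : n + 2 - 1 = n + 1 := by omega
    simp only [e1, integral_one_div_pow hn hr hrη.le] at hup hlo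
    have hF := radialSol_sq_le (m := n + 2) (by omega) hr.le (hrη.le.trans hη1)
    have hF1 := one_le_pow₀ (n := 2) (one_le_radialSol (m := n + 2) (by omega) r)
    have hN := radialQuot_pos (m := n + 2) (by omega) hr hrη.le
    rw [traceConstSq, e1]
    set N := radialQuot (n + 2) η r
    set F := radialSol (n + 2) r ^ 2
    set a := r ^ (n + 1) / η ^ (n + 2) with ha
    have ha0 : 0 < a := by positivity
    have hX : r ^ (n + 1) / η ^ n = a * η ^ 2 := by rw [ha]; field_simp; ring
    have hrn : 0 < r ^ (n + 1) := by positivity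
    have hup' := mul_le_mul_of_nonneg_left hup hrn.le
    have hlo' := mul_le_mul_of_nonneg_left hlo hrn.le
    push_cast at hup' hlo'
    have e2 : r ^ (n + 1) * (((n : ℝ) + 2) / η ^ (n + 2) + (1 / r ^ n - 1 / η ^ n) / n) =
        (n + 2) * a + (r - a * η ^ 2) / n := by
      rw [← hX, ha]; field_simp; ring
    have e3 : r ^ (n + 1) * (((n : ℝ) + 2) / η ^ (n + 2) * (1 - 4 * η ^ 2) +
        (1 / r ^ n - 1 / η ^ n) / n - 4 * r ^ 2 / r ^ (n + 1) * (η - r)) =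
        (n + 2) * a * (1 - 4 * η ^ 2) + (r - a * η ^ 2) / n - 4 * r ^ 2 * (η - r) := by
      rw [← hX, ha]; field_simp; ring
    rw [e2] at hup'
    rw [e3] at hlo'
    have e4 : ((n : ℝ) + 2) * r ^ (n + 1) / η ^ (n + 2) = (n + 2) * a := by rw [ha]; ring
    rw [e4]
    set X := a * η ^ 2 with hXdef
    have hX0 : 0 < X := by positivity
    set y := r ^ (n + 1) * N
    have hy0 : 0 < y := by positivity
    have e5 : r ^ (n + 1) * F * N = F * y := by ring
    rw [e5]
    -- Because `r < η`, the product of the correction `8r²` in `f(r)²` with the main term fits into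
    -- the first error term.
    have hrX : r ^ 2 * a ≤ X := by
      rw [hXdef, mul_comm]
      gcongr
    have hXn : X / n ≤ X := div_le_self hX0.le hn'
    have hXn0 : 0 ≤ X / n := by positivity
    have hrn1 : r / n ≤ r := div_le_self hr.le hn'
    rw [sub_div] at hup' hlo'
    have hr1 : r < 1 := hrη.trans_le hη1
    rw [abs_le]
    constructor
    · have h1 : y ≤ F * y := le_mul_of_one_le_left hy0.le hF1
      have h2 : ((n : ℝ) + 2) * a * (1 - 4 * η ^ 2) = (n + 2) * a - 4 * (n + 2) * X := by
        rw [hXdef]; ring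
      have h3 : 4 * r ^ 2 * (η - r) ≤ 4 * r ^ 2 :=
        mul_le_of_le_one_right (by positivity) (by linarith)
      have h4 : 0 ≤ (n : ℝ) * X := by positivity
      have h5 : 0 ≤ (n : ℝ) * r ^ 2 := by positivity
      have h6 : 0 ≤ r ^ 2 := by positivity
      linarith
    · have h1 : F * y ≤ (1 + 8 * r ^ 2) * ((n + 2) * a + r) := by
        refine mul_le_mul hF ?_ hy0.le (by positivity)
        linarith
      have h0 : F * y ≤ (1 + 8 * r ^ 2) * y := by gcongr
      have h2 : 8 * r ^ 2 * y ≤ 8 * r ^ 2 * ((n + 2) * a + r) := by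
        gcongr
        linarith
      have h3 : r ^ 2 * r ≤ r ^ 2 := mul_le_of_le_one_right (by positivity) hr1.le
      have h4 : ((n : ℝ) + 2) * (r ^ 2 * a) ≤ (n + 2) * X := by gcongr
      have h5 : 0 ≤ (n : ℝ) * r ^ 2 := by positivity
      have h6 : 0 ≤ r ^ 2 := by positivity
      linarith
  · intro t ht
    have ht0 := hr.trans_le ht.1
    obtain ⟨k, rfl⟩ : ∃ k, n = k + 1 := ⟨n - 1, by omega⟩
    have e : ∀ x : ℝ, 0 < x → 4 * x ^ 2 / x ^ (k + 1 + 1) = 4 / x ^ k := by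
      intro x hx
      field_simp
      ring
    rw [show k + 1 + 2 - 1 = k + 1 + 1 by omega, e t ht0, e r hr]
    have := ht.1
    gcongr

theorem abs_traceConstSq_sub_le_of_two {r η κ : ℝ} (hr : 0 < r) (hrη : r < η) (hη : η ≤ 1 / 3)
    (hκ : 0 ≤ κ) (hκ1 : κ ≤ 1) :
    |traceConstSq 2 η r - 2 * r / η ^ 2 - (κ - Real.log r) * r| ≤
      24 * (r / η ^ 2 * (-Real.log η * η ^ 2) + r ^ 2) := by
  have hη0 := hr.trans hrη
  have hη1 : η ≤ 1 := by linarith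
  have hup := radialQuot_le (m := 2) (by omega) hr hrη.le
  have hlo := le_radialQuot (m := 2) (K := 4) (by omega) hr hrη.le hη1 ?_
  · have hlog : ∫ t in r..η, 1 / t ^ (2 - 1) = Real.log η - Real.log r := by
      rw [← Real.log_div hη0.ne' hr.ne', ← integral_one_div_of_pos hr hη0]
      simp
    rw [hlog] at hup hlo
    have hF := radialSol_sq_le (m := 2) (by omega) hr.le (hrη.le.trans hη1)
    have hF1 := one_le_pow₀ (n := 2) (one_le_radialSol (m := 2) (by omega) r)
    have hN := radialQuot_pos (m := 2) (by omega) hr hrη.le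
    -- From `η ≤ 1/3 ≤ 1/e`; hence multiples of `r`, among them `κ r`, are absorbed by `-r log η`.
    have hl1 : 1 ≤ -Real.log η := by
      rw [le_neg, Real.log_le_iff_le_exp hη0, Real.exp_neg]
      refine hη.trans ?_
      rw [one_div]
      exact inv_anti₀ (Real.exp_pos 1) (Real.exp_one_lt_d9.le.trans (by norm_num))
    have hlr : Real.log r < Real.log η := Real.log_lt_log hr hrη
    have hlr' : -Real.log r * r ≤ 1 := by
      have h := Real.one_sub_inv_le_log_of_pos hr
      have h2 := mul_le_mul_of_nonneg_right h hr.le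
      rw [sub_mul, inv_mul_cancel₀ hr.ne'] at h2
      linarith
    rw [traceConstSq]
    norm_num only [pow_one] at hup hlo ⊢
    set N := radialQuot 2 η r
    set F := radialSol 2 r ^ 2
    set l := -Real.log η with hl
    set L := Real.log r
    set a := r / η ^ 2 with ha
    have ha0 : 0 < a := by positivity
    have haη : a * η ^ 2 = r := by rw [ha]; field_simp
    have hup' := mul_le_mul_of_nonneg_left hup hr.le
    have hlo' := mul_le_mul_of_nonneg_left hlo hr.le
    have e1 : r * (2 / η ^ 2 + (Real.log η - L)) = 2 * a + (-l - L) * r := by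
      rw [ha, hl]; ring
    have e2 : r * (2 / η ^ 2 * (1 - 4 * η ^ 2) + (Real.log η - L) - 4 * (η - r)) =
        2 * a - 8 * r + (-l - L) * r - 4 * r * (η - r) := by
      rw [ha, hl]; field_simp; ring
    rw [e1] at hup'
    rw [e2] at hlo'
    have e3 : 2 * r / η ^ 2 = 2 * a := by rw [ha]; ring
    have e4 : a * (l * η ^ 2) = l * r := by rw [mul_left_comm, haη]
    have e5 : r * F * N = F * (r * N) := by ring
    rw [e3, e4, e5]
    set y := r * N
    have hy0 : 0 < y := by positivity
    have hrl : r ≤ l * r := le_mul_of_one_le_left hr.le hl1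
    have hκr : κ * r ≤ r := mul_le_of_le_one_left hr.le hκ1
    have hκ0 : 0 ≤ κ * r := by positivity
    have hr2 : 0 ≤ r ^ 2 := sq_nonneg r
    rw [abs_le]
    constructor
    · have h1 : y ≤ F * y := le_mul_of_one_le_left hy0.le hF1
      have h2 : 4 * r * (η - r) ≤ 4 * r :=
        mul_le_of_le_one_right (by positivity) (by linarith)
      linarith
    · have h0 : F * y ≤ (1 + 8 * r ^ 2) * y := by gcongr
      have h1 : 8 * r ^ 2 * y ≤ 8 * r ^ 2 * (2 * a + 1) := by
        gcongr
        linarith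
      have h2 : r ^ 2 * a ≤ r := by
        calc r ^ 2 * a ≤ η ^ 2 * a := by gcongr
          _ = r := by rw [mul_comm, haη]
      linarith
  · intro t ht
    have ht0 := hr.trans_le ht.1
    have ht1 := ht.2.trans hη1
    norm_num only [pow_one]
    rw [div_le_iff₀ ht0]
    nlinarith

end SobolevTrace

/-! ### The theorem in all dimensions -/

theorem mainTheorem9 (m : ℕ) (hm : 2 ≤ m) :
    (0.115 < Real.log 2 - Real.eulerMascheroniConstant ∧
      Real.log 2 - Real.eulerMascheroniConstant < 0.116) ∧
    (∀ r η : ℝ, 0 < r → r < η →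
      SobolevTrace.optTraceConst m r η ≠ ⊤ ∧
      (SobolevTrace.optTraceConst m r η).toReal ^ 2 =
        (m : ℝ) * r ^ (m - 1) / η ^ m + SobolevTrace.hTerm m r +
          SobolevTrace.remainder m r η) ∧
    ∃ c' ηm : ℝ, 0 < c' ∧ 0 < ηm ∧ ηm ≤ 1 ∧
      (∀ r η : ℝ, 0 < r → r < η → η < ηm →
        |SobolevTrace.remainder m r η| ≤
          c' * (r ^ (m - 1) / η ^ m *
            (SobolevTrace.bracketTwo m (-Real.log η) * η ^ 2) + r ^ 2)) ∧
      (∀ η : ℝ, 0 < η → η < ηm →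
        MonotoneOn (fun r : ℝ => SobolevTrace.optTraceConst m r η) (Set.Ioo 0 η)) := by
  have hγ := SobolevTrace.log_two_sub_eulerMascheroniConstant_bounds
  -- `8 (m + 1)` is `24` for `m = 2` and `8 (n + 3)` for `m = n + 2`. The threshold `1/3` makes
  -- `-log η ≥ 1` when `m = 2`; the other estimates need only `η ≤ 1`.
  refine ⟨hγ, fun r η hr hrη => ⟨?_, ?_⟩, 8 * (m + 1), 1 / 3, by positivity, by norm_num,
    by norm_num, fun r η hr hrη hη => ?_, fun η _ hη => ?_⟩
  · rw [SobolevTrace.optTraceConst_eq hm hr hrη]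
    exact ENNReal.ofReal_ne_top
  · rw [SobolevTrace.remainder]
    ring
  · have hA := (SobolevTrace.traceConstSq_pos (m := m) (by omega) hr hrη.le).le
    rw [SobolevTrace.remainder, SobolevTrace.optTraceConst_eq hm hr hrη,
      ENNReal.toReal_ofReal (Real.sqrt_nonneg _), Real.sq_sqrt hA]
    rcases hm.eq_or_lt with rfl | hm3
    · have h := SobolevTrace.abs_traceConstSq_sub_le_of_two
        (κ := Real.log 2 - Real.eulerMascheroniConstant) hr hrη hη.le (by linarith [hγ.1])
        (by linarith [hγ.2])
      simp only [SobolevTrace.hTerm, SobolevTrace.bracketTwo, if_true]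
      norm_num at h ⊢
      exact h
    · obtain ⟨n, rfl⟩ : ∃ n, m = n + 2 := ⟨m - 2, by omega⟩
      have h := SobolevTrace.abs_traceConstSq_sub_le_of_three_le (n := n) (by omega) hr hrη
        (by linarith)
      have hne : n + 2 ≠ 2 := by omega
      simp only [SobolevTrace.hTerm, SobolevTrace.bracketTwo, hne, if_false]
      rw [show n + 2 - 1 = n + 1 by omega]
      push_cast
      rw [add_sub_cancel_right, one_mul, show (n : ℝ) + 2 + 1 = n + 3 by ring]
      exact h
  · intro r hr s hs hrs
    simp only
    rw [SobolevTrace.optTraceConst_eq hm hr.1 hr.2, SobolevTrace.optTraceConst_eq hm hs.1 hs.2]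
    exact ENNReal.ofReal_le_ofReal (Real.sqrt_le_sqrt
      (SobolevTrace.monotoneOn_traceConstSq hm (by linarith) hr hs hrs))
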